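/- Let $n,d\ge 1$, let $\Omega\subset\mathbb{R}^n$ be open and bounded, and let $S^{d-1}$ be the unit sphere of $\mathbb{R}^d$. Let $$f\colon \overline{\Omega}\times[0,1]\times S^{d-1}\times S^{d-1}\to\mathbb{R},\qquad (x,\tau,\xi,\zeta)\mapsto f(x,\tau,\xi,\zeta),$$ be continuous and bounded, and assume that for every $x\in\overline\Omega$ the mappings $(\xi,\zeta)\mapsto f(x,0,\xi,\zeta)$ and $(\xi,\zeta)\mapsto f(x,1,\xi,\zeta)$ are constant. For $u,v\in L^1(\Omega;\mathbb{R}^d)$ put $$F(u,v)=\int_\Omega f\Bigl(x,\frac{|u|}{|u|+|v|},\frac{u}{|u|},\frac{v}{|v|}\Bigr)\,(|u|+|v|)\,dx,$$ where $u/|u|$ (respectively $v/|v|$) is an arbitrary unit vector where $u=0$ (respectively $v=0$), and the integrand is $0$ where $u=v=0$. Let $\mathcal{M}(\Omega;\mathbb{R}^d)$ be the space of finite $\mathbb{R}^d$-valued Radon measures on $\Omega$, let $|\mu|$ be the total variation measure of $\mu$, let $\mathcal{L}^n$ be Lebesgue measure, and let $\rightharpoonup^*$ denote weak* convergence in $\mathcal{M}(\Omega;\mathbb{R}^d)$,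 that is, convergence of the integrals of every $\varphi\in C_0(\Omega)$. For $\mu,\nu\in\mathcal{M}(\Omega;\mathbb{R}^d)$ define $$\hat F(\mu,\nu):=\inf\Bigl\{\liminf_{k\to\infty} F(u_k,v_k) : u_k,v_k\in L^1(\Omega;\mathbb{R}^d),\ u_k\mathcal{L}^n\rightharpoonup^*\mu,\ v_k\mathcal{L}^n\rightharpoonup^*\nu,\ \|u_k\|_{L^1}\to|\mu|(\Omega),\ \|v_k\|_{L^1}\to|\nu|(\Omega)\Bigr\}.$$ Let $f_c$ be the lower semicontinuous convex hull of $f$ with respect to $\tau$: for fixed $(x,\xi,\zeta)$, $f_c(x,\cdot,\xi,\zeta)$ is the pointwise supremum of all convex lower semicontinuous functions on $[0,1]$ that are $\le f(x,\cdot,\xi,\zeta)$. Then, for all $\mu,\nu\in\mathcal{M}(\Omega;\mathbb{R}^d)$, the function $x\mapsto f_c\bigl(x,\frac{d|\mu|}{d(|\mu|+|\nu|)},\frac{d\mu}{d|\mu|},\frac{d\nu}{d|\nu|}\bigr)$ is integrable with respect to $|\mu|+|\nu|$ and $$\hat F(\mu,\nu)=F_c(\mu,\nu):=\int_\Omega f_c\Bigl(x,\frac{d|\mu|}{d(|\mu|+|\nu|)},\frac{d\mu}{d|\mu|},\frac{d\nu}{d|\nu|}\Bigr)\,d(|\mu|+|\nu|),$$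 where $d\mu/d|\mu|$ and $d\nu/d|\nu|$ are given arbitrary fixed values in $S^{d-1}$ outside sets of full $|\mu|$- and $|\nu|$-measure, respectively. -/

import Mathlib

open MeasureTheory Filter Set Topology
open scoped ZeroAtInfty ENNReal

noncomputable section

/-- Euclidean space `ℝⁿ`. -/
abbrev Euc (n : ℕ) : Type := EuclideanSpace ℝ (Fin n)

/-- The unit sphere `S^{d-1}` in `ℝᵈ`. -/
abbrev USphere (d : ℕ) : Type := Metric.sphere (0 : Euc d) 1

/-- The domain `closure Ω × [0,1] × S^{d-1} × S^{d-1}` of the integrands; the one-dimensional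
simplex is identified with `[0,1]`. -/
abbrev IntegrandDomain {n : ℕ} (Ω : Set (Euc n)) (d : ℕ) : Type :=
  closure Ω × Icc (0 : ℝ) 1 × USphere d × USphere d

/-- A point of `Ω` seen as a point of the closure of `Ω`. -/
def toClosure {n : ℕ} {Ω : Set (Euc n)} (x : Ω) : closure Ω := ⟨x, subset_closure x.2⟩

/-- The direction `w / |w|` of a vector; for `w = 0` an arbitrary fixed unit vector. -/
def unitDir {d : ℕ} [NeZero d] (w : Euc d) : USphere d :=
  if h : w = 0 then ⟨EuclideanSpace.single 0 1, by simp⟩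
  else ⟨‖w‖⁻¹ • w, by simp [norm_smul, h]⟩

/-- The ratio `|p| / (|p| + |q|) ∈ [0,1]` (with value `0` when `p = q = 0`). -/
def massRatio {d : ℕ} (p q : Euc d) : Icc (0 : ℝ) 1 :=
  ⟨‖p‖ / (‖p‖ + ‖q‖), by positivity,
    div_le_one_of_le₀ (le_add_of_nonneg_right (norm_nonneg q)) (by positivity)⟩

/-- The Lebesgue measure `𝓛ⁿ` on `Ω`. -/
def leb {n : ℕ} (Ω : Set (Euc n)) : Measure Ω := Measure.comap (↑) (volume : Measure (Euc n))

/-- `F(u,v) = ∫_Ω f(x, |u|/(|u|+|v|), u/|u|, v/|v|) (|u|+|v|) dx` for `u, v ∈ L¹(Ω;ℝᵈ)`. -/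
def lebFunctional {n d : ℕ} [NeZero d] {Ω : Set (Euc n)} (f : IntegrandDomain Ω d → ℝ)
    (u v : Lp (Euc d) 1 (leb Ω)) : ℝ :=
  ∫ x : Ω, f (toClosure x, massRatio (u x) (v x), unitDir (u x), unitDir (v x))
    * (‖u x‖ + ‖v x‖) ∂(leb Ω)

/-- `IsLscConvexMinorant h g`: `g` is a convex, lower semicontinuous function on `[0,1]`
lying below `h`. -/
def IsLscConvexMinorant (h : Icc (0 : ℝ) 1 → ℝ) (g : ℝ → ℝ) : Prop :=
  ConvexOn ℝ (Icc 0 1) g ∧ LowerSemicontinuousOn g (Icc 0 1) ∧ ∀ s : Icc (0 : ℝ) 1, g s ≤ h s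

/-- The lower semicontinuous convex hull of `h : [0,1] → ℝ`: the pointwise supremum of all
convex, lower semicontinuous functions below `h`. -/
def lscConvexHull (h : Icc (0 : ℝ) 1 → ℝ) (t : Icc (0 : ℝ) 1) : ℝ :=
  sSup {y : ℝ | ∃ g : ℝ → ℝ, IsLscConvexMinorant h g ∧ y = g t}

/-- `f_c`: the lower semicontinuous convex hull of `f` in its second variable. -/
def hullInRatio {n d : ℕ} {Ω : Set (Euc n)} (f : IntegrandDomain Ω d → ℝ) :
    IntegrandDomain Ω d → ℝ :=
  fun p => lscConvexHull (fun s => f (p.1, s, p.2.2.1, p.2.2.2)) p.2.1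

/-- The `ℝᵈ`-valued Radon measures on `Ω`: countably additive `ℝᵈ`-valued set functions on the
Borel sets of `Ω`. They are automatically of finite total variation and regular. The total
variation measure is `VectorMeasure.variation`. -/
abbrev RadonVec {n : ℕ} (Ω : Set (Euc n)) (d : ℕ) : Type := VectorMeasure Ω (Euc d)

/-- The `i`-th component of a vector measure, a signed measure. -/
def component {n d : ℕ} {Ω : Set (Euc n)} (μ : RadonVec Ω d) (i : Fin d) : SignedMeasure Ω :=
  μ.mapRange (EuclideanSpace.proj i : Euc d →L[ℝ] ℝ).toLinearMap.toAddMonoidHom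
    (EuclideanSpace.proj i : Euc d →L[ℝ] ℝ).continuous

/-- The Radon-Nikodym density `dμ/d|μ|`, computed componentwise. -/
def density {n d : ℕ} {Ω : Set (Euc n)} (μ : RadonVec Ω d) (x : Ω) : Euc d :=
  WithLp.toLp 2 fun i => (component μ i).rnDeriv μ.variation x

/-- The density `dμ/d|μ|` as a map into the sphere: it has norm `1` at `|μ|`-a.e. point, so it is
`|μ|`-a.e. unchanged by the normalisation, which only fixes values on a `|μ|`-null set. -/
def polarDir {n d : ℕ} [NeZero d] {Ω : Set (Euc n)} (μ : RadonVec Ω d) (x : Ω) : USphere d :=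
  unitDir (density μ x)

/-- The density `d|μ|/d(|μ|+|ν|)` as a map into `[0,1]` (where its values are almost everywhere). -/
def variationRatio {n d : ℕ} {Ω : Set (Euc n)} (μ ν : RadonVec Ω d) (x : Ω) : Icc (0 : ℝ) 1 :=
  projIcc 0 1 zero_le_one (μ.variation.rnDeriv (μ.variation + ν.variation) x).toReal

/-- The function `x ↦ g(x, d|μ|/d(|μ|+|ν|), dμ/d|μ|, dν/d|ν|)` on `Ω`. -/
def measIntegrand {n d : ℕ} [NeZero d] {Ω : Set (Euc n)} (g : IntegrandDomain Ω d → ℝ)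
    (μ ν : RadonVec Ω d) (x : Ω) : ℝ :=
  g (toClosure x, variationRatio μ ν x, polarDir μ x, polarDir ν x)

/-- `∫_Ω g(x, d|μ|/d(|μ|+|ν|), dμ/d|μ|, dν/d|ν|) d(|μ|+|ν|)`. -/
def measFunctional {n d : ℕ} [NeZero d] {Ω : Set (Euc n)} (g : IntegrandDomain Ω d → ℝ)
    (μ ν : RadonVec Ω d) : ℝ :=
  ∫ x : Ω, measIntegrand g μ ν x ∂(μ.variation + ν.variation)

/-- Weak* convergence of vector measures: convergence of the integrals of all `φ ∈ C₀(Ω)`. -/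
def WeakStarTendsto {n d : ℕ} {Ω : Set (Euc n)} (μs : ℕ → RadonVec Ω d) (μ : RadonVec Ω d) :
    Prop :=
  ∀ φ : C₀(Ω, ℝ), Tendsto
    (fun k => (μs k).integral (fun x => φ x) (ContinuousLinearMap.lsmul ℝ ℝ)) atTop
    (𝓝 (μ.integral (fun x => φ x) (ContinuousLinearMap.lsmul ℝ ℝ)))

/-- Strict convergence of the measures `u_k 𝓛ⁿ`, `u_k ∈ L¹(Ω;ℝᵈ)`, to `μ`: weak* convergence
together with `‖u_k‖_{L¹} → |μ|(Ω)`. -/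
def StrictTendsto {n d : ℕ} {Ω : Set (Euc n)} (u : ℕ → Lp (Euc d) 1 (leb Ω))
    (μ : RadonVec Ω d) : Prop :=
  WeakStarTendsto (fun k => (leb Ω).withDensityᵥ (u k)) μ ∧
    Tendsto (fun k => ‖u k‖) atTop (𝓝 (μ.variation univ).toReal)

/-- The relaxation `inf {liminf_k F(u_k,v_k)}` over all sequences `u_k`, `v_k` in `L¹(Ω;ℝᵈ)` such
that `u_k 𝓛ⁿ → μ` and `v_k 𝓛ⁿ → ν` strictly, as an extended real number. -/
def relaxation {n d : ℕ} [NeZero d] {Ω : Set (Euc n)} (f : IntegrandDomain Ω d → ℝ)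
    (μ ν : RadonVec Ω d) : EReal :=
  sInf {L : EReal | ∃ u v : ℕ → Lp (Euc d) 1 (leb Ω),
    StrictTendsto u μ ∧ StrictTendsto v ν ∧
      L = liminf (fun k => (lebFunctional f (u k) (v k) : EReal)) atTop}

end

open scoped RealInnerProductSpace

theorem isCompact_convexHull_of_isCompact {E : Type*} [NormedAddCommGroup E] [NormedSpace ℝ E]
    [FiniteDimensional ℝ E] {s : Set E} (hs : IsCompact s) : IsCompact (convexHull ℝ s) := by
  have hcpt : IsCompact ((stdSimplex ℝ (Fin (Module.finrank ℝ E + 1))) ×ˢ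
      (Set.univ.pi fun _ : Fin (Module.finrank ℝ E + 1) => s)) :=
    (isCompact_stdSimplex ℝ _).prod (isCompact_univ_pi fun _ => hs)
  have himg := hcpt.image (f := fun p : (Fin (Module.finrank ℝ E + 1) → ℝ) ×
    (Fin (Module.finrank ℝ E + 1) → E) => ∑ i, p.1 i • p.2 i) (by fun_prop)
  convert himg
  apply Subset.antisymm
  · intro x hx
    obtain ⟨ι, _, z, w, hz, haff, hw, hw1, hx⟩ := eq_pos_convex_span_of_mem_convexHull hx
    have hcard : Fintype.card ι ≤ Fintype.card (Fin (Module.finrank ℝ E + 1)) := by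
      have := haff.card_le_finrank_succ
      simp only [Fintype.card_fin]
      exact this.trans (Nat.add_le_add_right (Submodule.finrank_le _) 1)
    obtain ⟨e⟩ := Function.Embedding.nonempty_of_card_le hcard
    have hne : Nonempty ι := by
      by_contra hc
      rw [not_nonempty_iff] at hc
      simp at hw1
    obtain ⟨i₀⟩ := hne
    have hwe : ∀ j, j ∉ range e → Function.extend e w 0 j = 0 := fun j hj => by
      rw [Function.extend_apply' _ _ _ hj]; rfl
    refine ⟨(Function.extend e w 0, Function.extend e z fun _ => z i₀), ⟨⟨fun j => ?_, ?_⟩, ?_⟩, ?_⟩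
    · by_cases hj : j ∈ range e
      · obtain ⟨i, rfl⟩ := hj
        simpa [e.injective.extend_apply] using (hw i).le
      · exact (hwe j hj).ge
    · rw [← hw1]
      exact (Fintype.sum_of_injective e e.injective _ _ (fun j hj => hwe j hj)
        (fun i => by simp [e.injective.extend_apply])).symm
    · intro j _
      by_cases hj : j ∈ range e
      · obtain ⟨i, rfl⟩ := hj
        simpa [e.injective.extend_apply] using hz ⟨i, rfl⟩
      · simpa [Function.extend_apply' _ _ _ hj] using hz ⟨i₀, rfl⟩
    · rw [← hx]
      exact (Fintype.sum_of_injective e e.injective _ _ (fun j hj => by simp [hwe j hj])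
        (fun i => by simp [e.injective.extend_apply])).symm
  · rintro _ ⟨⟨w, z⟩, ⟨hw, hz⟩, rfl⟩
    exact (convex_convexHull ℝ s).sum_mem (fun i _ => hw.1 i) hw.2
      fun i _ => subset_convexHull ℝ s (hz i trivial)

theorem lscConvexHull_bddAbove (h : Icc (0 : ℝ) 1 → ℝ) (t : Icc (0 : ℝ) 1) :
    BddAbove {y : ℝ | ∃ g : ℝ → ℝ, IsLscConvexMinorant h g ∧ y = g t} := by
  refine ⟨h t, ?_⟩
  rintro _ ⟨g, hg, rfl⟩
  exact hg.2.2 t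

theorem le_lscConvexHull {h : Icc (0 : ℝ) 1 → ℝ} {a b : ℝ}
    (hab : ∀ s : Icc (0 : ℝ) 1, a * s + b * (1 - s) ≤ h s) (t : Icc (0 : ℝ) 1) :
    a * t + b * (1 - t) ≤ lscConvexHull h t := by
  refine le_csSup (lscConvexHull_bddAbove h t) ⟨fun x => a * x + b * (1 - x), ⟨?_, ?_, hab⟩, rfl⟩
  · refine ⟨convex_Icc 0 1, fun x _ y _ p q _ _ hpq => le_of_eq ?_⟩
    simp only [smul_eq_mul]
    linear_combination -b * hpq
  · exact (by fun_prop : Continuous fun x : ℝ => a * x + b * (1 - x)).lowerSemicontinuous.lowerSemicontinuousOn _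

theorem lscConvexHull_duality (h : C(Icc (0 : ℝ) 1, ℝ)) (t : Icc (0 : ℝ) 1) :
    (∃ (ι : Type) (_ : Fintype ι) (w : ι → ℝ) (s : ι → Icc (0 : ℝ) 1), (∀ i, 0 ≤ w i) ∧
      ∑ i, w i = 1 ∧ ∑ i, w i * s i = t ∧ ∑ i, w i * h (s i) = lscConvexHull h t) ∧
    ∀ y < lscConvexHull h t, ∃ a b : ℝ, (∀ s : Icc (0 : ℝ) 1, a * s + b * (1 - s) ≤ h s) ∧
      y < a * t + b * (1 - t) := by
  set G : Set (ℝ × ℝ) := convexHull ℝ (range fun s : Icc (0 : ℝ) 1 => ((s : ℝ), h s)) with hG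
  have hGc : IsCompact G := isCompact_convexHull_of_isCompact (isCompact_range (by fun_prop))
  have hmem : ∀ s : Icc (0 : ℝ) 1, ((s : ℝ), h s) ∈ G := fun s => subset_convexHull ℝ _ ⟨s, rfl⟩
  have hKc : IsCompact (G ∩ {p | p.1 = t}) :=
    hGc.inter_right (isClosed_eq continuous_fst continuous_const)
  obtain ⟨⟨t', y₀⟩, ⟨hy₀, rfl : t' = t⟩, hmin⟩ := hKc.exists_isMinOn ⟨_, hmem t, rfl⟩
    continuous_snd.continuousOn
  have hsep : ∀ y < y₀, ∃ a b : ℝ, (∀ s : Icc (0 : ℝ) 1, a * s + b * (1 - s) ≤ h s) ∧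
      y < a * t + b * (1 - t) := by
    intro y hy
    have hnot : ((t : ℝ), y) ∉ G := fun hc => absurd (hmin ⟨hc, rfl⟩) (not_le.2 hy)
    obtain ⟨F, u, hu, hF⟩ := geometric_hahn_banach_point_closed (convex_convexHull ℝ _)
      hGc.isClosed hnot
    have hdec : ∀ x z : ℝ, F (x, z) = x * F (1, 0) + z * F (0, 1) := by
      intro x z
      have : ((x, z) : ℝ × ℝ) = x • ((1, 0) : ℝ × ℝ) + z • ((0, 1) : ℝ × ℝ) := by simp
      rw [this, map_add, map_smul, map_smul]; simp
    set p := F (1, 0)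
    set q := F (0, 1)
    have hq : 0 < q := by
      have h1 := hF _ hy₀
      rw [hdec] at h1 hu
      by_contra hc
      nlinarith
    rw [hdec] at hu
    refine ⟨(u - p) / q, u / q, fun s => ?_, ?_⟩
    · have h1 := hF _ (hmem s)
      rw [hdec] at h1
      rw [div_mul_eq_mul_div, div_mul_eq_mul_div, ← add_div, div_le_iff₀ hq]
      linarith
    · rw [div_mul_eq_mul_div, div_mul_eq_mul_div, ← add_div, lt_div_iff₀ hq]
      linarith
  obtain ⟨ι, hι, w, z, hw, hw1, hz, hsum⟩ := mem_convexHull_iff_exists_fintype.1 hy₀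
  choose s hs using hz
  have hz' : ∀ i, z i = ((s i : ℝ), h (s i)) := fun i => (hs i).symm
  have e1 : ∑ i, w i * (s i : ℝ) = t := by
    have := congrArg Prod.fst hsum
    simpa [Prod.fst_sum, hz'] using this
  have e2 : ∑ i, w i * h (s i) = y₀ := by
    have := congrArg Prod.snd hsum
    simpa [Prod.snd_sum, hz'] using this
  have hle : lscConvexHull h t ≤ y₀ := by
    obtain ⟨a, b, hab, -⟩ := hsep (y₀ - 1) (by linarith)
    refine csSup_le ⟨_, _, ⟨(?_ : ConvexOn ℝ (Icc (0 : ℝ) 1) fun _ => -‖h‖), ?_, fun x => ?_⟩, rfl⟩ ?_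
    · exact convexOn_const _ (convex_Icc 0 1)
    · exact lowerSemicontinuousOn_const
    · have := h.norm_coe_le_norm x
      exact (abs_le.1 this).1
    · rintro _ ⟨g, hg, rfl⟩
      have := hg.1.map_sum_le (t := Finset.univ) (fun i _ => hw i) hw1 (fun i _ => (s i).2)
      simp only [smul_eq_mul] at this
      rw [e1] at this
      rw [← e2]
      exact this.trans (Finset.sum_le_sum fun i _ => mul_le_mul_of_nonneg_left (hg.2.2 _) (hw i))
  have hge : y₀ ≤ lscConvexHull h t := by
    refine le_of_forall_lt fun y hy => ?_
    obtain ⟨a, b, hab, hlt⟩ := hsep y hy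
    exact hlt.trans_le (le_lscConvexHull hab t)
  have heq : lscConvexHull h t = y₀ := le_antisymm hle hge
  rw [heq]
  exact ⟨⟨ι, hι, w, s, hw, hw1, e1, e2⟩, hsep⟩

theorem lscConvexHull_le_of_le_add {h k : C(Icc (0 : ℝ) 1, ℝ)} {δ : ℝ} (hhk : ∀ s, h s ≤ k s + δ)
    (t : Icc (0 : ℝ) 1) : lscConvexHull h t ≤ lscConvexHull k t + δ := by
  refine le_of_forall_lt fun y hy => ?_
  obtain ⟨a, b, hab, hlt⟩ := (lscConvexHull_duality h t).2 y hy
  have := le_lscConvexHull (h := k) (a := a - δ) (b := b - δ)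
    (fun s => by linarith [hab s, hhk s]) t
  linarith

/-- Along a segment towards a point `r`, the hull lies below the chord. -/
theorem lscConvexHull_segment_le (h : C(Icc (0 : ℝ) 1, ℝ)) {t s r : Icc (0 : ℝ) 1} {θ : ℝ}
    (h0 : 0 ≤ θ) (h1 : θ ≤ 1) (hs : (s : ℝ) = (1 - θ) * t + θ * r) :
    lscConvexHull h s ≤ (1 - θ) * lscConvexHull h t + θ * h r := by
  refine le_of_forall_lt fun y hy => ?_
  obtain ⟨a, b, hab, hlt⟩ := (lscConvexHull_duality h s).2 y hy
  have e : a * s + b * (1 - s) = (1 - θ) * (a * t + b * (1 - t)) + θ * (a * r + b * (1 - r)) := by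
    rw [hs]; ring
  have i1 := mul_le_mul_of_nonneg_left (le_lscConvexHull hab t) (sub_nonneg.2 h1)
  have i2 := mul_le_mul_of_nonneg_left (hab r) h0
  linarith

theorem continuous_lscConvexHull (h : C(Icc (0 : ℝ) 1, ℝ)) : Continuous (lscConvexHull h) := by
  rw [continuous_iff_lower_upperSemicontinuous]
  constructor
  · intro t y hy
    obtain ⟨a, b, hab, hlt⟩ := (lscConvexHull_duality h t).2 y hy
    have hc : Continuous fun s : Icc (0 : ℝ) 1 => a * (s : ℝ) + b * (1 - s) := by fun_prop
    filter_upwards [hc.continuousAt.eventually (lt_mem_nhds hlt)] with s hs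
    exact hs.trans_le (le_lscConvexHull hab s)
  · intro t y hy
    have hr : ∀ s : Icc (0 : ℝ) 1, t ≤ s → lscConvexHull h s ≤
        (1 - ((s : ℝ) - t) / (1 - t)) * lscConvexHull h t + ((s : ℝ) - t) / (1 - t) * h 1 := by
      intro s hts
      have hts' : (t : ℝ) ≤ s := hts
      rcases eq_or_lt_of_le t.2.2 with ht | ht
      · have : s = t := le_antisymm (Subtype.coe_le_coe.1 (by rw [ht]; exact s.2.2)) hts
        simp [this]
      · have hpos : 0 < 1 - (t : ℝ) := by linarith
        refine lscConvexHull_segment_le h (div_nonneg (by linarith) hpos.le)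
          ((div_le_one hpos).2 (by linarith [s.2.2])) ?_
        simp only [Icc.coe_one]
        field_simp
        ring
    have hl : ∀ s : Icc (0 : ℝ) 1, s ≤ t → lscConvexHull h s ≤
        (1 - ((t : ℝ) - s) / t) * lscConvexHull h t + ((t : ℝ) - s) / t * h 0 := by
      intro s hts
      have hts' : (s : ℝ) ≤ t := hts
      rcases eq_or_lt_of_le t.2.1 with ht | ht
      · have : s = t := le_antisymm hts (Subtype.coe_le_coe.1 (by rw [← ht]; exact s.2.1))
        simp [this]
      · refine lscConvexHull_segment_le h (div_nonneg (by linarith) ht.le)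
          ((div_le_one ht).2 (by linarith [s.2.1])) ?_
        simp only [Icc.coe_zero]
        field_simp
        ring
    have cr : Continuous fun s : Icc (0 : ℝ) 1 =>
        (1 - ((s : ℝ) - t) / (1 - t)) * lscConvexHull h t + ((s : ℝ) - t) / (1 - t) * h 1 := by
      fun_prop
    have cl : Continuous fun s : Icc (0 : ℝ) 1 =>
        (1 - ((t : ℝ) - s) / t) * lscConvexHull h t + ((t : ℝ) - s) / t * h 0 := by fun_prop
    filter_upwards [cr.continuousAt.eventually (gt_mem_nhds (by simpa using hy)),
      cl.continuousAt.eventually (gt_mem_nhds (by simpa using hy))] with s h1 h2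
    rcases le_total t s with hts | hts
    · exact (hr s hts).trans_lt h1
    · exact (hl s hts).trans_lt h2

theorem continuous_lscConvexHull_uncurry :
    Continuous fun p : C(Icc (0 : ℝ) 1, ℝ) × Icc (0 : ℝ) 1 => lscConvexHull p.1 p.2 := by
  refine continuous_prod_of_continuous_lipschitzWith _ 1 continuous_lscConvexHull fun t => ?_
  refine LipschitzWith.of_le_add fun h k => lscConvexHull_le_of_le_add (fun s => ?_) t
  have := (abs_le.1 ((Real.dist_eq _ _).symm.le.trans (ContinuousMap.dist_apply_le_dist (f := h) (g := k) s))).2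
  linarith

section HullInRatio

variable {n d : ℕ} {Ω : Set (Euc n)} {f : IntegrandDomain Ω d → ℝ}

/-- The section `s ↦ f (x, s, ξ, ζ)` as a continuous map. -/
def ratioSection (hf : Continuous f) (p : IntegrandDomain Ω d) : C(Icc (0 : ℝ) 1, ℝ) :=
  ⟨fun s => f (p.1, s, p.2.2.1, p.2.2.2), by fun_prop⟩

theorem continuous_hullInRatio (hf : Continuous f) : Continuous (hullInRatio f) := by
  have h1 : Continuous (ratioSection hf) := by
    let F : C(IntegrandDomain Ω d × Icc (0 : ℝ) 1, ℝ) :=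
      ⟨fun q => f (q.1.1, q.2, q.1.2.2.1, q.1.2.2.2), by fun_prop⟩
    exact F.curry.continuous
  exact continuous_lscConvexHull_uncurry.comp (h1.prodMk (by fun_prop : Continuous
    fun p : IntegrandDomain Ω d => p.2.1))

end HullInRatio

theorem integral_withDensityᵥ_lsmul {X E : Type*} [MeasurableSpace X] [NormedAddCommGroup E]
    [NormedSpace ℝ E] [CompleteSpace E] {m : Measure X} {g : X → E} (hg : Integrable g m)
    {φ : X → ℝ} (hφ : Integrable φ (m.withDensityᵥ g).variation) :
    (m.withDensityᵥ g).integral φ (ContinuousLinearMap.lsmul ℝ ℝ) = ∫ x, φ x • g x ∂m := by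
  have hvar := Measure.variation_withDensityᵥ hg
  have hfin : IsFiniteMeasure (m.withDensityᵥ g).variation := by
    rw [hvar]
    exact ⟨by simpa using! hg.2⟩
  have hg' : AEMeasurable (fun x => ‖g x‖ₑ) m := hg.aestronglyMeasurable.enorm
  have hlt : ∀ᵐ x ∂m, ‖g x‖ₑ < ∞ := by filter_upwards with x using by simp
  have hdir : AEStronglyMeasurable (fun x => ‖g x‖⁻¹ • g x) m :=
    hg.aestronglyMeasurable.norm.inv₀.smul hg.aestronglyMeasurable
  have hdir' : AEStronglyMeasurable (fun x => ‖g x‖⁻¹ • g x) (m.withDensityᵥ g).variation := by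
    rw [hvar]; exact hdir.mono_ac (withDensity_absolutelyContinuous _ _)
  have hb : ∀ᵐ x ∂(m.withDensityᵥ g).variation, ‖‖g x‖⁻¹ • g x‖ ≤ 1 := by
    filter_upwards with x using by simp [norm_smul, inv_mul_le_one]
  have hint : ∀ φ : X → ℝ, Integrable φ (m.withDensityᵥ g).variation →
      Integrable (fun x => φ x • (‖g x‖⁻¹ • g x)) (m.withDensityᵥ g).variation :=
    fun φ hφ => hφ.smul_bdd 1 hdir' hb
  have hrew : ∀ φ : X → ℝ, ∫ x, φ x • (‖g x‖⁻¹ • g x) ∂(m.withDensityᵥ g).variation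
      = ∫ x, φ x • g x ∂m := by
    intro φ
    rw [hvar, integral_withDensity_eq_integral_toReal_smul₀ hg' hlt]
    refine integral_congr_ae (.of_forall fun x => ?_)
    simp only [toReal_enorm]
    rcases eq_or_ne (g x) 0 with h | h
    · simp [h]
    · rw [smul_comm, smul_smul ‖g x‖, mul_inv_cancel₀ (by simpa using h), one_smul]
  rw [← hrew]
  revert φ
  refine Integrable.induction _ ?_ ?_ ?_ ?_
  · intro c s hs _
    rw [VectorMeasure.integral_indicator_const _ hs, hrew, withDensityᵥ_apply hg hs]
    simp only [ContinuousLinearMap.lsmul_apply]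
    rw [← integral_smul, ← integral_indicator hs]
    congr 1 with x
    by_cases hx : x ∈ s <;> simp [hx]
  · intro φ ψ _ hφ hψ h1 h2
    rw [VectorMeasure.integral_add hφ hψ, h1, h2, ← integral_add (hint _ hφ) (hint _ hψ)]
    simp [add_smul]
  · refine isClosed_eq VectorMeasure.continuous_integral ?_
    refine (LipschitzWith.of_dist_le_mul (K := 1) fun φ ψ => ?_).continuous
    rw [dist_eq_norm, ← integral_sub (hint _ (L1.integrable_coeFn φ)) (hint _ (L1.integrable_coeFn ψ)),
      dist_eq_norm, L1.norm_eq_integral_norm, NNReal.coe_one, one_mul]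
    refine (norm_integral_le_integral_norm _).trans (integral_mono_ae ?_ ?_ ?_)
    · exact ((hint _ (L1.integrable_coeFn φ)).sub (hint _ (L1.integrable_coeFn ψ))).norm
    · exact (L1.integrable_coeFn _).norm
    · filter_upwards [Lp.coeFn_sub φ ψ, hb] with x hx hb
      rw [hx, ← sub_smul, norm_smul]
      exact (mul_le_mul_of_nonneg_left hb (norm_nonneg _)).trans (by simp)
  · intro φ ψ h _ h1
    rw [← VectorMeasure.integral_congr_ae h, h1]
    refine integral_congr_ae ?_
    filter_upwards [h] with x hx using by rw [hx]

section Directions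

variable {d : ℕ} [NeZero d]

theorem norm_smul_unitDir (w : Euc d) : ‖w‖ • (unitDir w : Euc d) = w := by
  unfold unitDir
  split_ifs with h
  · simp [h]
  · simp [smul_smul, h]

theorem unitDir_smul {c : ℝ} (hc : 0 < c) (ξ : USphere d) : unitDir (c • (ξ : Euc d)) = ξ := by
  have hn : ‖(ξ : Euc d)‖ = 1 := by simp
  have hne : c • (ξ : Euc d) ≠ 0 := by
    rw [← norm_ne_zero_iff, norm_smul, hn]; simpa using hc.ne'
  apply Subtype.ext
  rw [unitDir, dif_neg hne]
  simp only [norm_smul, hn, mul_one, Real.norm_of_nonneg hc.le]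
  rw [smul_smul, inv_mul_cancel₀ hc.ne', one_smul]

theorem measurable_unitDir : Measurable (unitDir : Euc d → USphere d) := by
  refine Measurable.subtype_mk (h := fun w => (unitDir w).2)
    (f := fun w : Euc d => (unitDir w : Euc d)) ?_
  have : (fun w : Euc d => (unitDir w : Euc d)) = fun w => if w = 0 then
      EuclideanSpace.single 0 1 else ‖w‖⁻¹ • w := by
    ext1 w
    unfold unitDir
    split_ifs <;> rfl
  rw [this]
  exact Measurable.ite (measurableSet_singleton 0) measurable_const (by fun_prop)

omit [NeZero d] in
theorem measurable_massRatio :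
    Measurable fun p : Euc d × Euc d => massRatio p.1 p.2 :=
  Measurable.subtype_mk (by fun_prop)

omit [NeZero d] in
theorem massRatio_mul (p q : Euc d) : (massRatio p q : ℝ) * (‖p‖ + ‖q‖) = ‖p‖ := by
  rcases eq_or_ne (‖p‖ + ‖q‖) 0 with h | h
  · rw [h]; linarith [norm_nonneg p, norm_nonneg q]
  · simp [massRatio, h]

end Directions

section RadonVec

variable {n d : ℕ} {Ω : Set (Euc n)} (μ ν : RadonVec Ω d)

theorem component_apply (i : Fin d) (E : Set Ω) : component μ i E = μ E i := rfl

instance isFiniteMeasure_variation : IsFiniteMeasure μ.variation := by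
  refine isFiniteMeasure_of_le (∑ i, (component μ i).totalVariation)
    (VectorMeasure.variation_le_of_forall_enorm_le fun E _ => ?_)
  calc ‖μ E‖ₑ = ‖∑ i, (μ E i) • EuclideanSpace.basisFun (Fin d) ℝ i‖ₑ := by
        conv_lhs => rw [← (EuclideanSpace.basisFun (Fin d) ℝ).sum_repr (μ E)]
        simp
    _ ≤ ∑ i, ‖(μ E i) • EuclideanSpace.basisFun (Fin d) ℝ i‖ₑ := enorm_sum_le _ _
    _ = ∑ i, ‖component μ i E‖ₑ := by
        refine Finset.sum_congr rfl fun i _ => ?_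
        rw [component_apply, enorm_smul]
        simp [← ofReal_norm]
    _ ≤ ∑ i, (component μ i).totalVariation E :=
        Finset.sum_le_sum fun i _ => SignedMeasure.enorm_le_totalVariation _ _
    _ = _ := by simp

theorem integrable_density : Integrable (density μ) μ.variation :=
  Integrable.of_eval_piLp fun i => SignedMeasure.integrable_rnDeriv (component μ i) _

theorem withDensityᵥ_density : μ.variation.withDensityᵥ (density μ) = μ := by
  ext E hE i
  rw [withDensityᵥ_apply (integrable_density μ) hE, eval_integral_piLp]
  · have h := SignedMeasure.withDensityᵥ_rnDeriv_eq (component μ i) μ.variation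
      (VectorMeasure.AbsolutelyContinuous.mk fun s hs h0 => ?_)
    · have h' : (μ.variation.withDensityᵥ ((component μ i).rnDeriv μ.variation)) E =
        component μ i E := by rw [h]
      rw [withDensityᵥ_apply (SignedMeasure.integrable_rnDeriv _ _) hE] at h'
      exact h'
    · rw [component_apply]
      rw [Measure.toENNRealVectorMeasure_apply_measurable hs] at h0
      have : ‖μ s‖ₑ ≤ 0 := h0 ▸ VectorMeasure.enorm_measure_le_variation μ s
      simp_all
  · exact fun i => (SignedMeasure.integrable_rnDeriv (component μ i) _).integrableOn

theorem norm_density : ∀ᵐ x ∂μ.variation, ‖density μ x‖ = 1 := by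
  have h := Measure.variation_withDensityᵥ (integrable_density μ)
  rw [withDensityᵥ_density] at h
  have h1 : μ.variation.withDensity (fun x => ‖density μ x‖ₑ) = μ.variation.withDensity 1 := by
    rw [← h, withDensity_one]
  rw [withDensity_eq_iff (integrable_density μ).aestronglyMeasurable.enorm measurable_one.aemeasurable
    (integrable_density μ).2.ne] at h1
  filter_upwards [h1] with x hx
  have := congrArg ENNReal.toReal hx
  simpa using this

theorem measurable_density : Measurable (density μ) :=
  (PiLp.continuous_toLp 2 _).measurable.comp (measurable_pi_lambda _ fun i =>
    SignedMeasure.measurable_rnDeriv (component μ i) _)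

variable [NeZero d]

theorem measurable_polarDir : Measurable (polarDir μ) :=
  measurable_unitDir.comp (measurable_density μ)

theorem coe_polarDir_ae : ∀ᵐ x ∂μ.variation, (polarDir μ x : Euc d) = density μ x := by
  filter_upwards [norm_density μ] with x hx
  have := norm_smul_unitDir (density μ x)
  rwa [hx, one_smul] at this

theorem integral_eq_integral_polarDir {φ : Ω → ℝ} (hφ : Integrable φ μ.variation) :
    μ.integral φ (ContinuousLinearMap.lsmul ℝ ℝ) =
      ∫ x, φ x • (polarDir μ x : Euc d) ∂μ.variation := by
  have h := integral_withDensityᵥ_lsmul (integrable_density μ) (φ := φ)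
    (by rwa [withDensityᵥ_density])
  rw [withDensityᵥ_density] at h
  rw [h]
  refine integral_congr_ae ?_
  filter_upwards [coe_polarDir_ae μ] with x hx
  rw [hx]

omit [NeZero d] in
theorem measurable_variationRatio : Measurable (variationRatio μ ν) :=
  continuous_projIcc.measurable.comp (Measure.measurable_rnDeriv _ _).ennreal_toReal

omit [NeZero d] in
theorem coe_variationRatio_ae : ∀ᵐ x ∂(μ.variation + ν.variation),
    (variationRatio μ ν x : ℝ) = (μ.variation.rnDeriv (μ.variation + ν.variation) x).toReal := by
  filter_upwards [Measure.rnDeriv_le_one_of_le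
    (Measure.le_add_right le_rfl : μ.variation ≤ μ.variation + ν.variation)] with x hx
  have h2 : (μ.variation.rnDeriv (μ.variation + ν.variation) x).toReal ≤ 1 :=
    ENNReal.toReal_le_of_le_ofReal zero_le_one (by simpa using hx)
  simp [variationRatio, projIcc, h2]

omit [NeZero d] in
theorem integral_variationRatio_mul (k : Ω → ℝ) :
    ∫ x, (variationRatio μ ν x : ℝ) * k x ∂(μ.variation + ν.variation) =
      ∫ x, k x ∂μ.variation := by
  rw [← integral_rnDeriv_smul (f := k) (Measure.absolutelyContinuous_of_le
    (Measure.le_add_right le_rfl : μ.variation ≤ μ.variation + ν.variation))]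
  refine integral_congr_ae ?_
  filter_upwards [coe_variationRatio_ae μ ν] with x hx
  rw [hx, smul_eq_mul]

omit [NeZero d] in
theorem integral_one_sub_variationRatio_mul {k : Ω → ℝ}
    (hk : Integrable k (μ.variation + ν.variation)) :
    ∫ x, (1 - (variationRatio μ ν x : ℝ)) * k x ∂(μ.variation + ν.variation) =
      ∫ x, k x ∂ν.variation := by
  have hi : Integrable (fun x => (variationRatio μ ν x : ℝ) * k x)
      (μ.variation + ν.variation) := by
    refine hk.bdd_mul (c := 1)
      (measurable_subtype_coe.comp (measurable_variationRatio μ ν)).aestronglyMeasurable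
      (.of_forall fun x => ?_)
    rw [Real.norm_of_nonneg (variationRatio μ ν x).2.1]
    exact (variationRatio μ ν x).2.2
  simp only [sub_mul, one_mul]
  rw [integral_sub hk hi, integral_variationRatio_mul,
    integral_add_measure (integrable_add_measure.1 hk).1 (integrable_add_measure.1 hk).2]
  ring

/-- The point `(x, d|μ|/d(|μ|+|ν|), dμ/d|μ|, dν/d|ν|)`. -/
noncomputable def polarPoint (x : Ω) : Ω × Icc (0 : ℝ) 1 × USphere d × USphere d :=
  (x, variationRatio μ ν x, polarDir μ x, polarDir ν x)

theorem measurable_polarPoint : Measurable (polarPoint μ ν) :=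
  measurable_id.prodMk ((measurable_variationRatio μ ν).prodMk
    ((measurable_polarDir μ).prodMk (measurable_polarDir ν)))

end RadonVec

section StrictConvergence

variable {n d : ℕ} {Ω : Set (Euc n)} {u : ℕ → Lp (Euc d) 1 (leb Ω)} {μ : RadonVec Ω d}

theorem integrable_coeFn_one (w : Lp (Euc d) 1 (leb Ω)) : Integrable w (leb Ω) :=
  L1.integrable_coeFn w

instance isFiniteMeasure_variation_withDensityᵥ {X E : Type*} [MeasurableSpace X]
    [NormedAddCommGroup E] [NormedSpace ℝ E] [CompleteSpace E] (m : Measure X) (g : X → E) :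
    IsFiniteMeasure (m.withDensityᵥ g).variation := by
  by_cases hg : Integrable g m
  · rw [Measure.variation_withDensityᵥ hg]
    exact ⟨by simpa using! hg.2⟩
  · rw [Measure.withDensityᵥ, dif_neg hg]
    simp only [VectorMeasure.variation_zero]
    infer_instance

theorem integrable_of_continuous_of_bound {X E : Type*} [TopologicalSpace X] [MeasurableSpace X]
    [OpensMeasurableSpace X] [SecondCountableTopology X] [NormedAddCommGroup E]
    [SecondCountableTopology E]
    (m : Measure X) [IsFiniteMeasure m] {φ : X → E} (hφ : Continuous φ) {C : ℝ}
    (hC : ∀ x, ‖φ x‖ ≤ C) : Integrable φ m :=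
  Integrable.of_bound hφ.aestronglyMeasurable C (.of_forall hC)

variable [NeZero d]

theorem WeakStarTendsto.tendsto_integral_smul
    (h : WeakStarTendsto (fun k => (leb Ω).withDensityᵥ (u k)) μ) (φ : C₀(Ω, ℝ)) :
    Tendsto (fun k => ∫ x, φ x • u k x ∂(leb Ω)) atTop
      (𝓝 (∫ x, φ x • (polarDir μ x : Euc d) ∂μ.variation)) := by
  have hb : ∀ x, ‖φ x‖ ≤ ‖φ‖ := fun x => φ.toBCF.norm_coe_le_norm x
  have := h φ
  rw [integral_eq_integral_polarDir μ
    (integrable_of_continuous_of_bound _ (map_continuous φ) hb)] at this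
  refine this.congr fun k => ?_
  exact integral_withDensityᵥ_lsmul (integrable_coeFn_one (u k))
    (integrable_of_continuous_of_bound _ (map_continuous φ) hb)

theorem tendsto_integral_inner_of_hasCompactSupport
    (h : WeakStarTendsto (fun k => (leb Ω).withDensityᵥ (u k)) μ) {A : Ω → Euc d}
    (hA : Continuous A) (hAc : HasCompactSupport A) :
    Tendsto (fun k => ∫ x, ⟪A x, u k x⟫ ∂(leb Ω)) atTop
      (𝓝 (∫ x, ⟪A x, (polarDir μ x : Euc d)⟫ ∂μ.variation)) := by
  have hAi : ∀ i, Continuous fun x => A x i := fun i => by fun_prop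
  have hAic : ∀ i, HasCompactSupport fun x => A x i := fun i =>
    hAc.comp_left (g := fun w : Euc d => w i) rfl
  let φ : Fin d → C₀(Ω, ℝ) := fun i => ⟨⟨fun x => A x i, hAi i⟩, (hAic i).is_zero_at_infty⟩
  have hb : ∀ i x, ‖φ i x‖ ≤ ‖φ i‖ := fun i x => (φ i).toBCF.norm_coe_le_norm x
  have key : ∀ (m : Measure Ω) (w : Ω → Euc d), Integrable w m →
      ∫ x, ⟪A x, w x⟫ ∂m = ∑ i, (∫ x, φ i x • w x ∂m) i := by
    intro m w hw
    have hi : ∀ i, Integrable (fun x => φ i x • w x) m := fun i =>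
      hw.bdd_smul ‖φ i‖ (map_continuous (φ i)).aestronglyMeasurable (.of_forall (hb i))
    have hij : ∀ i j, Integrable (fun x => (φ i x • w x) j) m := fun i j =>
      (EuclideanSpace.proj (𝕜 := ℝ) j).integrable_comp (hi i)
    rw [Finset.sum_congr rfl fun i _ => eval_integral_piLp (hij i) i,
      ← integral_finsetSum _ fun i _ => hij i i]
    refine integral_congr_ae (.of_forall fun x => ?_)
    simp [PiLp.inner_apply, φ, mul_comm]
  have hp : Integrable (fun x => (polarDir μ x : Euc d)) μ.variation :=
    Integrable.of_bound (measurable_subtype_coe.comp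
      (measurable_polarDir μ)).aestronglyMeasurable 1 (.of_forall fun x => by simp)
  rw [key _ _ hp]
  refine (tendsto_finsetSum _ fun i _ => ?_).congr fun k =>
    (key _ _ (integrable_coeFn_one (u k))).symm
  exact ((EuclideanSpace.proj (𝕜 := ℝ) i).continuous.tendsto _).comp
    (h.tendsto_integral_smul (φ i))

omit [NeZero d] in
theorem one_sub_inner_truncation_le (g : Euc d) (ξ : USphere d) :
    1 - ⟪(max 1 ‖g‖)⁻¹ • g, (ξ : Euc d)⟫ ≤ 2 * ‖(ξ : Euc d) - g‖ := by
  have hξ : ‖(ξ : Euc d)‖ = 1 := by simp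
  have h1 : 1 - ⟪(max 1 ‖g‖)⁻¹ • g, (ξ : Euc d)⟫ =
      ⟪(ξ : Euc d) - (max 1 ‖g‖)⁻¹ • g, (ξ : Euc d)⟫ := by
    rw [inner_sub_left, real_inner_self_eq_norm_sq, hξ]; norm_num
  have h2 : ⟪(ξ : Euc d) - (max 1 ‖g‖)⁻¹ • g, (ξ : Euc d)⟫ ≤ ‖(ξ : Euc d) - (max 1 ‖g‖)⁻¹ • g‖ := by
    simpa [hξ] using real_inner_le_norm ((ξ : Euc d) - (max 1 ‖g‖)⁻¹ • g) (ξ : Euc d)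
  have h3 : ‖g - (max 1 ‖g‖)⁻¹ • g‖ ≤ ‖(ξ : Euc d) - g‖ := by
    rcases le_total ‖g‖ 1 with hg | hg
    · simp [max_eq_left hg]
    · rw [max_eq_right hg]
      have hpos : 0 < ‖g‖ := by linarith
      have : g - ‖g‖⁻¹ • g = ((‖g‖ - 1) * ‖g‖⁻¹) • g := by
        rw [sub_mul, mul_inv_cancel₀ hpos.ne', sub_smul, one_smul, one_mul]
      rw [this, norm_smul, norm_mul, norm_inv, norm_norm, mul_assoc, inv_mul_cancel₀ hpos.ne',
        mul_one, Real.norm_of_nonneg (by linarith), norm_sub_rev (ξ : Euc d)]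
      have := norm_sub_norm_le g (ξ : Euc d)
      rwa [hξ] at this
  have h4 := norm_sub_le_norm_sub_add_norm_sub (ξ : Euc d) g ((max 1 ‖g‖)⁻¹ • g)
  linarith

theorem StrictTendsto.eventually_lt_integral_norm (hΩ : IsOpen Ω) (h : StrictTendsto u μ)
    {ψ : Ω → ℝ} (hψ : Continuous ψ) (h0 : ∀ x, 0 ≤ ψ x) {M : ℝ} (hM : ∀ x, ψ x ≤ M) {ε : ℝ}
    (hε : 0 < ε) :
    ∀ᶠ k in atTop, ∫ x, ψ x ∂μ.variation - ε < ∫ x, ψ x * ‖u k x‖ ∂(leb Ω) := by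
  have : LocallyCompactSpace Ω := hΩ.locallyCompactSpace
  have hpm : AEStronglyMeasurable (fun x => (polarDir μ x : Euc d)) μ.variation :=
    (measurable_subtype_coe.comp (measurable_polarDir μ)).aestronglyMeasurable
  have hp : Integrable (fun x => (polarDir μ x : Euc d)) μ.variation :=
    Integrable.of_bound hpm 1 (.of_forall fun x => by simp)
  have hM' : 0 < |M| + 1 := by positivity
  obtain ⟨g, hgc, hge, hg, hgi⟩ := hp.exists_hasCompactSupport_integral_sub_le
    (ε := ε / (2 * (2 * (|M| + 1)))) (by positivity)
  set η : Ω → Euc d := fun x => ψ x • (max 1 ‖g x‖)⁻¹ • g x with hη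
  have hmax : ∀ x, 0 < max 1 ‖g x‖ := fun x => lt_max_of_lt_left one_pos
  have hmaxc : Continuous fun x => (max 1 ‖g x‖)⁻¹ :=
    (continuous_const.max hg.norm).inv₀ fun x => (hmax x).ne'
  have hηc : Continuous η := hψ.smul (hmaxc.smul hg)
  have hηs : HasCompactSupport η := hgc.mono fun x hx hgx => hx (by simp [hη, hgx])
  have hlim := tendsto_integral_inner_of_hasCompactSupport h.1 hηc hηs
  have hψb : ∀ x, ‖ψ x‖ ≤ |M| + 1 := fun x => by
    rw [Real.norm_of_nonneg (h0 x)]; linarith [hM x, le_abs_self M]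
  have hψi : Integrable ψ μ.variation := integrable_of_continuous_of_bound _ hψ hψb
  have htr : ∀ x, ‖(max 1 ‖g x‖)⁻¹ • g x‖ ≤ 1 := fun x => by
    rw [norm_smul, norm_inv, Real.norm_of_nonneg (hmax x).le, inv_mul_le_iff₀ (hmax x),
      mul_one]
    exact le_max_right _ _
  have hηb : ∀ x, ‖η x‖ ≤ |M| + 1 := fun x => by
    simp only [hη]
    rw [norm_smul]
    exact (mul_le_mul (hψb x) (htr x) (norm_nonneg _) hM'.le).trans (by simp)
  have hηi : Integrable (fun x => ⟪η x, (polarDir μ x : Euc d)⟫) μ.variation :=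
    Integrable.of_bound (hηc.aestronglyMeasurable.inner hpm) (|M| + 1) (.of_forall fun x =>
      (norm_inner_le_norm _ _).trans (by simpa using hηb x))
  have hlow : ∫ x, ψ x ∂μ.variation - ε / 2 ≤
      ∫ x, ⟪η x, (polarDir μ x : Euc d)⟫ ∂μ.variation := by
    have h1 : ∫ x, (ψ x - ⟪η x, (polarDir μ x : Euc d)⟫) ∂μ.variation ≤
        ∫ x, (2 * (|M| + 1)) * ‖(polarDir μ x : Euc d) - g x‖ ∂μ.variation := by
      refine integral_mono (hψi.sub hηi) ((hp.sub hgi).norm.const_mul _) fun x => ?_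
      have e : ψ x - ⟪η x, (polarDir μ x : Euc d)⟫ =
          ψ x * (1 - ⟪(max 1 ‖g x‖)⁻¹ • g x, (polarDir μ x : Euc d)⟫) := by
        simp only [hη, inner_smul_left (𝕜 := ℝ) (r := ψ x)]
        simp [mul_sub]
      have b := one_sub_inner_truncation_le (g x) (polarDir μ x)
      simp only [e]
      have c := hψb x
      rw [Real.norm_of_nonneg (h0 x)] at c
      calc _ ≤ ψ x * (2 * ‖(polarDir μ x : Euc d) - g x‖) := mul_le_mul_of_nonneg_left b (h0 x)
        _ ≤ (|M| + 1) * (2 * ‖(polarDir μ x : Euc d) - g x‖) := by gcongr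
        _ = _ := by ring
    rw [integral_sub hψi hηi, integral_const_mul] at h1
    have h2 := mul_le_mul_of_nonneg_left hge (by positivity : 0 ≤ 2 * (|M| + 1))
    have h3 : 2 * (|M| + 1) * (ε / (2 * (2 * (|M| + 1)))) = ε / 2 := by field_simp
    linarith
  have hlt : ∫ x, ψ x ∂μ.variation - ε < ∫ x, ⟪η x, (polarDir μ x : Euc d)⟫ ∂μ.variation := by
    linarith
  filter_upwards [hlim.eventually (lt_mem_nhds hlt)] with k hk
  refine hk.trans_le (integral_mono ?_ ?_ fun x => ?_)
  · refine ((integrable_coeFn_one (u k)).norm.const_mul (|M| + 1)).mono'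
      (hηc.aestronglyMeasurable.inner (integrable_coeFn_one (u k)).1) (.of_forall fun x => ?_)
    exact (norm_inner_le_norm _ _).trans (mul_le_mul_of_nonneg_right (hηb x) (norm_nonneg _))
  · exact (integrable_coeFn_one (u k)).norm.bdd_mul (c := |M| + 1) hψ.aestronglyMeasurable
      (.of_forall hψb)
  · refine (real_inner_le_norm _ _).trans (mul_le_mul_of_nonneg_right ?_ (norm_nonneg _))
    simp only [hη]
    rw [norm_smul, Real.norm_of_nonneg (h0 x)]
    exact mul_le_of_le_one_right (h0 x) (htr x)

theorem StrictTendsto.tendsto_integral_norm (hΩ : IsOpen Ω) (h : StrictTendsto u μ)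
    {a : Ω → ℝ} (ha : Continuous a) {M : ℝ} (hM : ∀ x, |a x| ≤ M) :
    Tendsto (fun k => ∫ x, a x * ‖u k x‖ ∂(leb Ω)) atTop (𝓝 (∫ x, a x ∂μ.variation)) := by
  have hi : Integrable a μ.variation := integrable_of_continuous_of_bound _ ha hM
  have hik : ∀ k, Integrable (fun x => a x * ‖u k x‖) (leb Ω) := fun k =>
    (integrable_coeFn_one (u k)).norm.bdd_mul (c := M) ha.aestronglyMeasurable (.of_forall hM)
  have hnorm : ∀ k, ∫ x, ‖u k x‖ ∂(leb Ω) = ‖u k‖ := fun k => (L1.norm_eq_integral_norm _).symm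
  have hmass := (h.2.const_mul M)
  rw [Metric.tendsto_atTop']
  intro ε hε
  have h1 := h.eventually_lt_integral_norm hΩ (ψ := fun x => a x + M) (by fun_prop)
    (fun x => by linarith [(abs_le.1 (hM x)).1]) (M := 2 * M)
    (fun x => by linarith [(abs_le.1 (hM x)).2]) (half_pos hε)
  have h2 := h.eventually_lt_integral_norm hΩ (ψ := fun x => M - a x) (by fun_prop)
    (fun x => by linarith [(abs_le.1 (hM x)).2]) (M := 2 * M)
    (fun x => by linarith [(abs_le.1 (hM x)).1]) (half_pos hε)
  have h3 := (Metric.tendsto_nhds.1 hmass) (ε / 2) (half_pos hε)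
  obtain ⟨N, hN⟩ := eventually_atTop.1 (h1.and (h2.and h3))
  refine ⟨N, fun k hk => ?_⟩
  obtain ⟨k1, k2, k3⟩ := hN k hk.le
  simp only [add_mul, sub_mul] at k1 k2
  have hMk : Integrable (fun x => M * ‖u k x‖) (leb Ω) :=
    (integrable_coeFn_one (u k)).norm.const_mul M
  rw [integral_add (hik k) hMk, integral_add hi (integrable_const _), integral_const_mul,
    hnorm, integral_const, smul_eq_mul, measureReal_def] at k1
  rw [integral_sub hMk (hik k), integral_sub (integrable_const _) hi, integral_const_mul,
    hnorm, integral_const, smul_eq_mul, measureReal_def] at k2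
  rw [Real.dist_eq, abs_lt] at k3 ⊢
  constructor <;> linarith [k3.1, k3.2, mul_comm M (μ.variation univ).toReal]

theorem exists_cutoff {X : Type*} [TopologicalSpace X] [NormalSpace X] [MeasurableSpace X]
    [BorelSpace X] [R1Space X] [WeaklyLocallyCompactSpace X] (m : Measure X) [m.Regular]
    [IsFiniteMeasure m] {E : Set X} (hE : MeasurableSet E) {ε : ℝ} (hε : 0 < ε) :
    ∃ χ : X → ℝ, Continuous χ ∧ HasCompactSupport χ ∧ (∀ x, 0 ≤ χ x ∧ χ x ≤ 1) ∧
      ∫ x, |E.indicator 1 x - χ x| ∂m ≤ ε := by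
  have h1 : Integrable (E.indicator (1 : X → ℝ)) m := (integrable_const (1 : ℝ)).indicator hE
  obtain ⟨g, hgc, hge, hg, hgi⟩ := h1.exists_hasCompactSupport_integral_sub_le hε
  have hb : ∀ x, 0 ≤ max 0 (min 1 (g x)) ∧ max 0 (min 1 (g x)) ≤ 1 := fun x =>
    ⟨le_max_left _ _, max_le zero_le_one (min_le_left _ _)⟩
  have hc : Continuous fun x => max 0 (min 1 (g x)) :=
    continuous_const.max (continuous_const.min hg)
  refine ⟨fun x => max 0 (min 1 (g x)), hc,
    hgc.comp_left (g := fun y => max 0 (min 1 y)) (by simp), hb, ?_⟩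
  refine (integral_mono ?_ (h1.sub hgi).norm fun x => ?_).trans hge
  · exact (h1.sub (Integrable.mono' (integrable_const (1 : ℝ))
      ((continuous_const.max (continuous_const.min continuous_id) :
        Continuous fun y : ℝ => max 0 (min 1 y)).comp_aestronglyMeasurable hgi.1) (.of_forall fun x => by
        rw [Real.norm_of_nonneg (hb x).1]; exact (hb x).2))).abs
  · simp only [Real.norm_eq_abs, Pi.sub_apply]
    by_cases hx : x ∈ E <;> simp [hx] <;> grind

theorem StrictTendsto.tendsto_integral_inner (hΩ : IsOpen Ω) (h : StrictTendsto u μ)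
    {A : Ω → Euc d} (hA : Continuous A) {M : ℝ} (hM : ∀ x, ‖A x‖ ≤ M) :
    Tendsto (fun k => ∫ x, ⟪A x, u k x⟫ ∂(leb Ω)) atTop
      (𝓝 (∫ x, ⟪A x, (polarDir μ x : Euc d)⟫ ∂μ.variation)) := by
  have : LocallyCompactSpace Ω := hΩ.locallyCompactSpace
  have hM' : 0 < |M| + 1 := by positivity
  have hb : ∀ x, ‖A x‖ ≤ |M| + 1 := fun x => by linarith [hM x, le_abs_self M]
  have hpm : AEStronglyMeasurable (fun x => (polarDir μ x : Euc d)) μ.variation :=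
    (measurable_subtype_coe.comp (measurable_polarDir μ)).aestronglyMeasurable
  rw [Metric.tendsto_atTop']
  intro ε hε
  obtain ⟨χ, hχ, hχc, hχb, hχe⟩ := exists_cutoff μ.variation MeasurableSet.univ
    (ε := ε / (4 * (|M| + 1))) (by positivity)
  have hχ1 : ∫ x, (1 - χ x) ∂μ.variation ≤ ε / (4 * (|M| + 1)) := by
    refine le_trans (le_of_eq (integral_congr_ae (.of_forall fun x => ?_))) hχe
    simp [abs_of_nonneg (sub_nonneg.2 (hχb x).2)]
  have hc : Continuous fun x => 1 - χ x := by fun_prop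
  have h1 := tendsto_integral_inner_of_hasCompactSupport h.1 (hχ.smul hA) hχc.smul_right
  have h2 := h.tendsto_integral_norm hΩ hc (M := 1)
    (fun x => abs_le.2 ⟨by linarith [(hχb x).2], by linarith [(hχb x).1]⟩)
  obtain ⟨N, hN⟩ := eventually_atTop.1 (((Metric.tendsto_nhds.1 h1) (ε / 4) (by positivity)).and
    ((Metric.tendsto_nhds.1 h2) (ε / (4 * (|M| + 1))) (by positivity)))
  refine ⟨N, fun k hk => ?_⟩
  obtain ⟨k1, k2⟩ := hN k hk.le
  have key : ∀ (m : Measure Ω) (w : Ω → Euc d), Integrable w m →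
      |∫ x, ⟪A x, w x⟫ ∂m - ∫ x, ⟪(χ • A) x, w x⟫ ∂m| ≤
        (|M| + 1) * ∫ x, (1 - χ x) * ‖w x‖ ∂m := by
    intro m w hw
    have i1 : Integrable (fun x => ⟪A x, w x⟫) m :=
      (hw.norm.const_mul (|M| + 1)).mono' (hA.aestronglyMeasurable.inner hw.1)
        (.of_forall fun x => (norm_inner_le_norm _ _).trans
          (mul_le_mul_of_nonneg_right (hb x) (norm_nonneg _)))
    have i2 : Integrable (fun x => ⟪(χ • A) x, w x⟫) m := by
      refine (hw.norm.const_mul (|M| + 1)).mono' ((hχ.smul hA).aestronglyMeasurable.inner hw.1)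
        (.of_forall fun x => (norm_inner_le_norm _ _).trans
          (mul_le_mul_of_nonneg_right ?_ (norm_nonneg _)))
      simp only [Pi.smul_apply', norm_smul, Real.norm_of_nonneg (hχb x).1]
      exact (mul_le_of_le_one_left (norm_nonneg _) (hχb x).2).trans (hb x)
    have i3 : Integrable (fun x => (1 - χ x) * ‖w x‖) m :=
      hw.norm.bdd_mul (c := 1) hc.aestronglyMeasurable (.of_forall fun x =>
        abs_le.2 ⟨by linarith [(hχb x).2], by linarith [(hχb x).1]⟩)
    rw [← integral_sub i1 i2, ← integral_const_mul]
    refine (norm_integral_le_integral_norm _).trans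
      (integral_mono (i1.sub i2).norm (i3.const_mul _) fun x => ?_)
    have e : ⟪A x, w x⟫ - ⟪(χ • A) x, w x⟫ = (1 - χ x) * ⟪A x, w x⟫ := by
      simp [inner_smul_left, sub_mul]
    show ‖⟪A x, w x⟫ - ⟪(χ • A) x, w x⟫‖ ≤ (|M| + 1) * ((1 - χ x) * ‖w x‖)
    rw [e, norm_mul, Real.norm_of_nonneg (sub_nonneg.2 (hχb x).2)]
    calc _ ≤ (1 - χ x) * ((|M| + 1) * ‖w x‖) := by
          refine mul_le_mul_of_nonneg_left ((norm_inner_le_norm (𝕜 := ℝ) _ _).trans ?_)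
            (sub_nonneg.2 (hχb x).2)
          exact mul_le_mul_of_nonneg_right (hb x) (norm_nonneg _)
      _ = _ := by ring
  have q1 := key _ _ (integrable_coeFn_one (u k))
  have q2 := key _ _ (Integrable.of_bound hpm 1 (.of_forall fun x => by simp) : Integrable
    (fun x => (polarDir μ x : Euc d)) μ.variation)
  simp only [norm_eq_of_mem_sphere, mul_one] at q2
  set δ := ε / (4 * (|M| + 1)) with hδ
  have hMδ : (|M| + 1) * δ = ε / 4 := by rw [hδ]; field_simp
  rw [Real.dist_eq, abs_lt] at k1 k2
  have r1 := mul_le_mul_of_nonneg_left hχ1 hM'.le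
  have r2 : (|M| + 1) * ∫ x, (1 - χ x) * ‖u k x‖ ∂(leb Ω) ≤ (|M| + 1) * (δ + δ) :=
    mul_le_mul_of_nonneg_left (by linarith [k2.2]) hM'.le
  rw [Real.dist_eq]
  rw [abs_le] at q1 q2
  rw [abs_lt]
  have k1' := k1.1
  have k1'' := k1.2
  constructor <;> linarith [q1.1, q1.2, q2.1, q2.2, k2.1, k2.2]

end StrictConvergence

/-- The domain `Ω × [0,1] × S^{d-1} × S^{d-1}` over the open set itself. -/
abbrev OpenDomain {n : ℕ} (Ω : Set (Euc n)) (d : ℕ) : Type :=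
  Ω × Icc (0 : ℝ) 1 × USphere d × USphere d

section Functional

variable {n d : ℕ} {Ω : Set (Euc n)}

/-- The inclusion of `OpenDomain Ω d` in `IntegrandDomain Ω d`. -/
def toIntegrandDomain (p : OpenDomain Ω d) : IntegrandDomain Ω d := (toClosure p.1, p.2)

theorem isometry_toIntegrandDomain : Isometry (toIntegrandDomain : OpenDomain Ω d → _) :=
  fun _ _ => rfl

theorem continuous_toIntegrandDomain : Continuous (toIntegrandDomain : OpenDomain Ω d → _) :=
  isometry_toIntegrandDomain.continuous

variable [NeZero d]

/-- The pointwise density of the functional of `(u, v)` with integrand `g`. -/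
noncomputable def pairDensity (g : OpenDomain Ω d → ℝ) (u v : Ω → Euc d) (x : Ω) : ℝ :=
  g (x, massRatio (u x) (v x), unitDir (u x), unitDir (v x)) * (‖u x‖ + ‖v x‖)

theorem lebFunctional_eq (f : IntegrandDomain Ω d → ℝ) (u v : Lp (Euc d) 1 (leb Ω)) :
    lebFunctional f u v = ∫ x, pairDensity (f ∘ toIntegrandDomain) u v x ∂(leb Ω) := rfl

theorem integrable_pairDensity {g : OpenDomain Ω d → ℝ} (hg : Continuous g) {C : ℝ}
    (hC : ∀ p, |g p| ≤ C) (u v : Lp (Euc d) 1 (leb Ω)) :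
    Integrable (pairDensity g u v) (leb Ω) := by
  refine Integrable.bdd_mul (c := C)
    ((integrable_coeFn_one u).norm.add (integrable_coeFn_one v).norm) ?_ (.of_forall fun x => hC _)
  have hu := (Lp.stronglyMeasurable u).measurable
  have hv := (Lp.stronglyMeasurable v).measurable
  exact (hg.measurable.comp (measurable_id.prodMk ((measurable_massRatio.comp
    (hu.prodMk hv)).prodMk ((measurable_unitDir.comp hu).prodMk
      (measurable_unitDir.comp hv))))).aestronglyMeasurable

omit [NeZero d] in
/-- The integrand which is affine in the ratio and in the directions with coefficients depending
on the point. -/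
noncomputable def affineIntegrand (a b : Ω → ℝ) (A B : Ω → Euc d) (p : OpenDomain Ω d) : ℝ :=
  p.2.1 * (a p.1 + ⟪A p.1, (p.2.2.1 : Euc d)⟫) +
    (1 - p.2.1) * (b p.1 + ⟪B p.1, (p.2.2.2 : Euc d)⟫)

theorem pairDensity_affineIntegrand (a b : Ω → ℝ) (A B : Ω → Euc d) (u v : Ω → Euc d) (x : Ω) :
    pairDensity (affineIntegrand a b A B) u v x =
      (a x * ‖u x‖ + ⟪A x, u x⟫) + (b x * ‖v x‖ + ⟪B x, v x⟫) := by
  have h1 := massRatio_mul (u x) (v x)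
  have h2 : (1 - (massRatio (u x) (v x) : ℝ)) * (‖u x‖ + ‖v x‖) = ‖v x‖ := by linarith
  have e1 : ⟪A x, u x⟫ = ‖u x‖ * ⟪A x, (unitDir (u x) : Euc d)⟫ := by
    conv_lhs => rw [← norm_smul_unitDir (u x), inner_smul_right]
  have e2 : ⟪B x, v x⟫ = ‖v x‖ * ⟪B x, (unitDir (v x) : Euc d)⟫ := by
    conv_lhs => rw [← norm_smul_unitDir (v x), inner_smul_right]
  simp only [pairDensity, affineIntegrand]
  rw [e1, e2]
  linear_combination (a x + ⟪A x, (unitDir (u x) : Euc d)⟫) * h1 +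
    (b x + ⟪B x, (unitDir (v x) : Euc d)⟫) * h2

/-- `ℓ` is an integrand below `g` which is affine in the ratio and in the directions, with
bounded continuous coefficients. -/
def IsAffineMinorant (g ℓ : OpenDomain Ω d → ℝ) : Prop :=
  ∃ (a b : Ω → ℝ) (A B : Ω → Euc d) (M : ℝ), (Continuous a ∧ Continuous b ∧ Continuous A ∧
    Continuous B) ∧ (∀ x, |a x| ≤ M ∧ |b x| ≤ M ∧ ‖A x‖ ≤ M ∧ ‖B x‖ ≤ M) ∧
    ℓ = affineIntegrand a b A B ∧ ∀ p, ℓ p ≤ g p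

omit [NeZero d]

theorem IsAffineMinorant.continuous {g ℓ : OpenDomain Ω d → ℝ} (h : IsAffineMinorant g ℓ) :
    Continuous ℓ := by
  obtain ⟨a, b, A, B, M, ⟨ha, hb, hA, hB⟩, -, rfl, -⟩ := h
  unfold affineIntegrand
  fun_prop

theorem IsAffineMinorant.exists_bound {g ℓ : OpenDomain Ω d → ℝ} (h : IsAffineMinorant g ℓ) :
    ∃ C, ∀ p, |ℓ p| ≤ C := by
  obtain ⟨a, b, A, B, M, -, hM, rfl, -⟩ := h
  refine ⟨2 * M, fun p => ?_⟩
  have h1 := (norm_inner_le_norm (𝕜 := ℝ) (A p.1) (p.2.2.1 : Euc d))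
  have h2 := (norm_inner_le_norm (𝕜 := ℝ) (B p.1) (p.2.2.2 : Euc d))
  obtain ⟨m1, m2, m3, m4⟩ := hM p.1
  simp only [norm_eq_of_mem_sphere, mul_one, Real.norm_eq_abs] at h1 h2
  have h0 := p.2.1.2.1
  have h0' := p.2.1.2.2
  have i1 : |a p.1 + ⟪A p.1, (p.2.2.1 : Euc d)⟫| ≤ 2 * M := (abs_add_le _ _).trans (by linarith)
  have i2 : |b p.1 + ⟪B p.1, (p.2.2.2 : Euc d)⟫| ≤ 2 * M := (abs_add_le _ _).trans (by linarith)
  unfold affineIntegrand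
  refine (abs_add_le _ _).trans ?_
  rw [abs_mul, abs_mul, abs_of_nonneg h0, abs_of_nonneg (by linarith : 0 ≤ 1 - (p.2.1 : ℝ))]
  have j1 := mul_le_mul_of_nonneg_left i1 h0
  have j2 := mul_le_mul_of_nonneg_left i2 (by linarith : 0 ≤ 1 - (p.2.1 : ℝ))
  linarith

theorem IsAffineMinorant.interpolate {g ℓ ℓ' : OpenDomain Ω d → ℝ} (h : IsAffineMinorant g ℓ)
    (h' : IsAffineMinorant g ℓ') {χ : Ω → ℝ} (hχ : Continuous χ)
    (h01 : ∀ x, 0 ≤ χ x ∧ χ x ≤ 1) :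
    IsAffineMinorant g fun p => χ p.1 * ℓ p + (1 - χ p.1) * ℓ' p := by
  obtain ⟨a, b, A, B, M, ⟨ha, hb, hA, hB⟩, hM, rfl, hle⟩ := h
  obtain ⟨a', b', A', B', M', ⟨ha', hb', hA', hB'⟩, hM', rfl, hle'⟩ := h'
  have comb : ∀ {E : Type} [NormedAddCommGroup E] [NormedSpace ℝ E] (y z : E) (x : Ω),
      ‖y‖ ≤ M → ‖z‖ ≤ M' → ‖χ x • y + (1 - χ x) • z‖ ≤ max M M' := by
    intro E _ _ y z x hy hz
    have := convex_closedBall (0 : E) (max M M')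
      (mem_closedBall_zero_iff.2 (hy.trans (le_max_left _ _)))
      (mem_closedBall_zero_iff.2 (hz.trans (le_max_right _ _))) (h01 x).1
      (sub_nonneg.2 (h01 x).2) (by ring)
    simpa using this
  refine ⟨fun x => χ x • a x + (1 - χ x) • a' x, fun x => χ x • b x + (1 - χ x) • b' x,
    fun x => χ x • A x + (1 - χ x) • A' x, fun x => χ x • B x + (1 - χ x) • B' x, max M M',
    ⟨by fun_prop, by fun_prop, by fun_prop, by fun_prop⟩,
    fun x => ⟨comb (a x) (a' x) x (hM x).1 (hM' x).1, comb (b x) (b' x) x (hM x).2.1 (hM' x).2.1,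
      comb _ _ x (hM x).2.2.1 (hM' x).2.2.1, comb _ _ x (hM x).2.2.2 (hM' x).2.2.2⟩, ?_, ?_⟩
  · ext p
    simp only [affineIntegrand, inner_add_left, inner_smul_left, smul_eq_mul]
    simp only [conj_trivial]
    ring
  · intro p
    have i1 := mul_le_mul_of_nonneg_left (hle p) (h01 p.1).1
    have i2 := mul_le_mul_of_nonneg_left (hle' p) (sub_nonneg.2 (h01 p.1).2)
    linarith

end Functional

section LowerBound

variable {n d : ℕ} [NeZero d] {Ω : Set (Euc n)} {μ ν : RadonVec Ω d}
  {u v : ℕ → Lp (Euc d) 1 (leb Ω)} {g ℓ : OpenDomain Ω d → ℝ}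

theorem integral_affineIntegrand_polarPoint {a b : Ω → ℝ} {A B : Ω → Euc d} (ha : Continuous a)
    (hb : Continuous b) (hA : Continuous A) (hB : Continuous B) {M : ℝ}
    (hM : ∀ x, |a x| ≤ M ∧ |b x| ≤ M ∧ ‖A x‖ ≤ M ∧ ‖B x‖ ≤ M) :
    ∫ x, affineIntegrand a b A B (polarPoint μ ν x) ∂(μ.variation + ν.variation) =
      (∫ x, a x ∂μ.variation + ∫ x, ⟪A x, (polarDir μ x : Euc d)⟫ ∂μ.variation) +
      (∫ x, b x ∂ν.variation + ∫ x, ⟪B x, (polarDir ν x : Euc d)⟫ ∂ν.variation) := by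
  have hin : ∀ (m : Measure Ω) [IsFiniteMeasure m] (ρ : RadonVec Ω d) {A : Ω → Euc d},
      Continuous A → (∀ x, ‖A x‖ ≤ M) →
      Integrable (fun x => ⟪A x, (polarDir ρ x : Euc d)⟫) m := by
    intro m _ ρ A hA hAM
    refine Integrable.of_bound (hA.aestronglyMeasurable.inner (measurable_subtype_coe.comp
      (measurable_polarDir ρ)).aestronglyMeasurable) M (.of_forall fun x => ?_)
    exact (norm_inner_le_norm _ _).trans (by simpa using hAM x)
  have hca : ∀ (m : Measure Ω) [IsFiniteMeasure m], Integrable a m := fun m _ =>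
    integrable_of_continuous_of_bound m ha fun x => (hM x).1
  have hcb : ∀ (m : Measure Ω) [IsFiniteMeasure m], Integrable b m := fun m _ =>
    integrable_of_continuous_of_bound m hb fun x => (hM x).2.1
  have hτ : AEStronglyMeasurable (fun x => (variationRatio μ ν x : ℝ))
      (μ.variation + ν.variation) :=
    (measurable_subtype_coe.comp (measurable_variationRatio μ ν)).aestronglyMeasurable
  simp only [affineIntegrand, polarPoint]
  rw [integral_add, integral_variationRatio_mul, integral_one_sub_variationRatio_mul,
    integral_add (hca _) (hin _ μ hA fun x => (hM x).2.2.1),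
    integral_add (hcb _) (hin _ ν hB fun x => (hM x).2.2.2)]
  · exact (hcb _).add (hin _ ν hB fun x => (hM x).2.2.2)
  · refine ((hca _).add (hin _ μ hA fun x => (hM x).2.2.1)).bdd_mul (c := 1) hτ
      (.of_forall fun x => ?_)
    rw [Real.norm_of_nonneg (variationRatio μ ν x).2.1]
    exact (variationRatio μ ν x).2.2
  · refine ((hcb _).add (hin _ ν hB fun x => (hM x).2.2.2)).bdd_mul (c := 1)
      (aestronglyMeasurable_const.sub hτ) (.of_forall fun x => ?_)
    rw [Real.norm_of_nonneg (by linarith [(variationRatio μ ν x).2.2])]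
    linarith [(variationRatio μ ν x).2.1]

theorem IsAffineMinorant.tendsto (hΩ : IsOpen Ω) (hℓ : IsAffineMinorant g ℓ)
    (hu : StrictTendsto u μ) (hv : StrictTendsto v ν) :
    Tendsto (fun k => ∫ x, pairDensity ℓ (u k) (v k) x ∂(leb Ω)) atTop
      (𝓝 (∫ x, ℓ (polarPoint μ ν x) ∂(μ.variation + ν.variation))) := by
  obtain ⟨a, b, A, B, M, ⟨ha, hb, hA, hB⟩, hM, rfl, -⟩ := hℓ
  rw [integral_affineIntegrand_polarPoint ha hb hA hB hM]
  simp only [pairDensity_affineIntegrand]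
  have h1 : ∀ {a : Ω → ℝ}, Continuous a → (∀ x, |a x| ≤ M) → ∀ w : Lp (Euc d) 1 (leb Ω),
      Integrable (fun x => a x * ‖w x‖) (leb Ω) := fun ha haM w =>
    (integrable_coeFn_one w).norm.bdd_mul (c := M) ha.aestronglyMeasurable (.of_forall haM)
  have h2 : ∀ {A : Ω → Euc d}, Continuous A → (∀ x, ‖A x‖ ≤ M) → ∀ w : Lp (Euc d) 1 (leb Ω),
      Integrable (fun x => ⟪A x, w x⟫) (leb Ω) := fun hA hAM w =>
    ((integrable_coeFn_one w).norm.const_mul M).mono'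
      (hA.aestronglyMeasurable.inner (integrable_coeFn_one w).1) (.of_forall fun x =>
        (norm_inner_le_norm _ _).trans (mul_le_mul_of_nonneg_right (hAM x) (norm_nonneg _)))
  have e : ∀ k, ∫ x, ((a x * ‖u k x‖ + ⟪A x, u k x⟫) + (b x * ‖v k x‖ + ⟪B x, v k x⟫)) ∂(leb Ω) =
      (∫ x, a x * ‖u k x‖ ∂(leb Ω) + ∫ x, ⟪A x, u k x⟫ ∂(leb Ω)) +
      (∫ x, b x * ‖v k x‖ ∂(leb Ω) + ∫ x, ⟪B x, v k x⟫ ∂(leb Ω)) := by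
    intro k
    have a1 := h1 ha (fun x => (hM x).1) (u k)
    have a2 := h2 hA (fun x => (hM x).2.2.1) (u k)
    have a3 := h1 hb (fun x => (hM x).2.1) (v k)
    have a4 := h2 hB (fun x => (hM x).2.2.2) (v k)
    rw [← integral_add a1 a2, ← integral_add a3 a4]
    exact integral_add (a1.add a2) (a3.add a4)
  simp only [e]
  exact ((hu.tendsto_integral_norm hΩ ha fun x => (hM x).1).add
    (hu.tendsto_integral_inner hΩ hA fun x => (hM x).2.2.1)).add
    ((hv.tendsto_integral_norm hΩ hb fun x => (hM x).2.1).add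
    (hv.tendsto_integral_inner hΩ hB fun x => (hM x).2.2.2))

theorem IsAffineMinorant.eventually_lt (hΩ : IsOpen Ω) (hℓ : IsAffineMinorant g ℓ)
    (hg : Continuous g) {C : ℝ} (hC : ∀ p, |g p| ≤ C)
    (hu : StrictTendsto u μ) (hv : StrictTendsto v ν) {y : ℝ}
    (hy : y < ∫ x, ℓ (polarPoint μ ν x) ∂(μ.variation + ν.variation)) :
    ∀ᶠ k in atTop, y < ∫ x, pairDensity g (u k) (v k) x ∂(leb Ω) := by
  obtain ⟨C', hC'⟩ := hℓ.exists_bound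
  have hle : ∀ p, ℓ p ≤ g p := by
    obtain ⟨a, b, A, B, M, -, -, -, hle⟩ := hℓ
    exact hle
  filter_upwards [(hℓ.tendsto hΩ hu hv).eventually (lt_mem_nhds hy)] with k hk
  refine hk.trans_le (integral_mono (integrable_pairDensity hℓ.continuous hC' _ _)
    (integrable_pairDensity hg hC _ _) fun x => ?_)
  exact mul_le_mul_of_nonneg_right (hle _) (by positivity)

/-- `k` is an `L¹`-limit of affine minorants of `g` along the points `polarPoint μ ν x`. -/
def IsMinorantLimit (g : OpenDomain Ω d → ℝ) (μ ν : RadonVec Ω d) (k : Ω → ℝ) : Prop :=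
  Integrable k (μ.variation + ν.variation) ∧ ∀ ε > 0, ∃ ℓ, IsAffineMinorant g ℓ ∧
    ∫ x, |ℓ (polarPoint μ ν x) - k x| ∂(μ.variation + ν.variation) ≤ ε

theorem IsAffineMinorant.integrable (hℓ : IsAffineMinorant g ℓ) :
    Integrable (fun x => ℓ (polarPoint μ ν x)) (μ.variation + ν.variation) := by
  obtain ⟨C, hC⟩ := hℓ.exists_bound
  exact Integrable.of_bound (hℓ.continuous.measurable.comp
    (measurable_polarPoint μ ν)).aestronglyMeasurable C (.of_forall fun x => hC _)

theorem IsAffineMinorant.isMinorantLimit (hℓ : IsAffineMinorant g ℓ) :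
    IsMinorantLimit g μ ν fun x => ℓ (polarPoint μ ν x) :=
  ⟨hℓ.integrable, fun ε hε => ⟨ℓ, hℓ, by simpa using hε.le⟩⟩

theorem IsMinorantLimit.sup (hΩ : IsOpen Ω) {k k' : Ω → ℝ} (hk : IsMinorantLimit g μ ν k)
    (hk' : IsMinorantLimit g μ ν k') : IsMinorantLimit g μ ν fun x => max (k x) (k' x) := by
  have : LocallyCompactSpace Ω := hΩ.locallyCompactSpace
  refine ⟨hk.1.sup hk'.1, fun ε hε => ?_⟩
  obtain ⟨ℓ, hℓ, h1⟩ := hk.2 (ε / 3) (by positivity)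
  obtain ⟨ℓ', hℓ', h2⟩ := hk'.2 (ε / 3) (by positivity)
  obtain ⟨C, hC⟩ := hℓ.exists_bound
  obtain ⟨C', hC'⟩ := hℓ'.exists_bound
  have hE : MeasurableSet {x | ℓ' (polarPoint μ ν x) ≤ ℓ (polarPoint μ ν x)} :=
    measurableSet_le (hℓ'.continuous.measurable.comp (measurable_polarPoint μ ν))
      (hℓ.continuous.measurable.comp (measurable_polarPoint μ ν))
  set E := {x | ℓ' (polarPoint μ ν x) ≤ ℓ (polarPoint μ ν x)} with hEdef
  obtain ⟨χ, hχ, -, hχb, hχe⟩ := exists_cutoff (μ.variation + ν.variation) hE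
    (ε := ε / (3 * (|C| + |C'| + 1))) (by positivity)
  have hℓ'' := hℓ.interpolate hℓ' hχ hχb
  refine ⟨_, hℓ'', ?_⟩
  have hχi : Integrable (fun x => |E.indicator 1 x - χ x|) (μ.variation + ν.variation) :=
    (((integrable_const (1 : ℝ)).indicator hE).sub (integrable_of_continuous_of_bound _ hχ
      (C := 1) fun x => abs_le.2 ⟨by linarith [(hχb x).1], (hχb x).2⟩)).abs
  have d1 : Integrable (fun x => |ℓ (polarPoint μ ν x) - k x|) (μ.variation + ν.variation) :=
    (hℓ.integrable.sub hk.1).abs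
  have d2 : Integrable (fun x => |ℓ' (polarPoint μ ν x) - k' x|) (μ.variation + ν.variation) :=
    (hℓ'.integrable.sub hk'.1).abs
  have hpt : ∀ x, |(χ (polarPoint μ ν x).1 * ℓ (polarPoint μ ν x) +
      (1 - χ (polarPoint μ ν x).1) * ℓ' (polarPoint μ ν x)) - max (k x) (k' x)| ≤
      (|C| + |C'| + 1) * |E.indicator 1 x - χ x| +
        (|ℓ (polarPoint μ ν x) - k x| + |ℓ' (polarPoint μ ν x) - k' x|) := by
    intro x
    have e0 : (polarPoint μ ν x).1 = x := rfl
    rw [e0]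
    set p := ℓ (polarPoint μ ν x)
    set q := ℓ' (polarPoint μ ν x)
    have hpq : |p - q| ≤ |C| + |C'| + 1 := (abs_sub _ _).trans (by
      linarith [hC (polarPoint μ ν x), hC' (polarPoint μ ν x), le_abs_self C, le_abs_self C'])
    have e1 : (χ x * p + (1 - χ x) * q) - max p q = (χ x - E.indicator 1 x) * (p - q) := by
      by_cases hx : x ∈ E
      · have hx' : q ≤ p := hx
        rw [max_eq_left hx', indicator_of_mem hx, Pi.one_apply]; ring
      · have hx' : p ≤ q := (not_le.1 hx).le
        rw [max_eq_right hx', indicator_of_notMem hx]; ring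
    have e2 : |max p q - max (k x) (k' x)| ≤ |p - k x| + |q - k' x| :=
      (abs_max_sub_max_le_max _ _ _ _).trans
        (max_le_add_of_nonneg (abs_nonneg _) (abs_nonneg _))
    calc _ ≤ |(χ x * p + (1 - χ x) * q) - max p q| + |max p q - max (k x) (k' x)| :=
          abs_sub_le _ _ _
      _ ≤ _ := by
        refine add_le_add ?_ e2
        rw [e1, abs_mul, mul_comm, abs_sub_comm (χ x)]
        exact mul_le_mul_of_nonneg_right hpq (abs_nonneg _)
  calc _ ≤ ∫ x, ((|C| + |C'| + 1) * |E.indicator 1 x - χ x| +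
        (|ℓ (polarPoint μ ν x) - k x| + |ℓ' (polarPoint μ ν x) - k' x|))
          ∂(μ.variation + ν.variation) :=
        integral_mono (hℓ''.integrable.sub (hk.1.sup hk'.1)).abs
          ((hχi.const_mul _).add (d1.add d2)) hpt
    _ = (|C| + |C'| + 1) * ∫ x, |E.indicator 1 x - χ x| ∂(μ.variation + ν.variation) +
        (∫ x, |ℓ (polarPoint μ ν x) - k x| ∂(μ.variation + ν.variation) +
          ∫ x, |ℓ' (polarPoint μ ν x) - k' x| ∂(μ.variation + ν.variation)) := by
        rw [← integral_const_mul, ← integral_add d1 d2]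
        exact integral_add (hχi.const_mul _) (d1.add d2)
    _ ≤ (|C| + |C'| + 1) * (ε / (3 * (|C| + |C'| + 1))) + (ε / 3 + ε / 3) := by gcongr
    _ = ε := by field_simp; ring

theorem exists_penalty {X : Type*} [TopologicalSpace X] [CompactSpace X] {D Q : X → ℝ}
    (hD : Continuous D) (hQ : Continuous Q) (hQ0 : ∀ x, 0 ≤ Q x) (hDQ : ∀ x, Q x = 0 → D x ≤ 0)
    {ε : ℝ} (hε : 0 < ε) : ∃ C, 0 ≤ C ∧ ∀ x, D x ≤ ε + C * Q x := by
  have hS : IsCompact {x | ε ≤ D x} := (isClosed_le continuous_const hD).isCompact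
  rcases {x | ε ≤ D x}.eq_empty_or_nonempty with he | hne
  · refine ⟨0, le_rfl, fun x => ?_⟩
    have : x ∉ {x | ε ≤ D x} := by rw [he]; exact notMem_empty x
    simpa using (not_le.1 this).le
  · obtain ⟨y, hy, hmin⟩ := hS.exists_isMinOn hne hQ.continuousOn
    obtain ⟨z, hz, hmax⟩ := hS.exists_isMaxOn hne hD.continuousOn
    have hq : 0 < Q y := lt_of_le_of_ne (hQ0 y) fun h0 => by
      have := hDQ y h0.symm
      have hy' : ε ≤ D y := hy
      linarith
    have hz' : 0 ≤ D z := hε.le.trans hz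
    refine ⟨D z / Q y, by positivity, fun x => ?_⟩
    by_cases hx : ε ≤ D x
    · have h1 : D x ≤ D z := hmax hx
      have h2 : Q y ≤ Q x := hmin hx
      have h3 : D z / Q y * Q y ≤ D z / Q y * Q x := by gcongr
      rw [div_mul_cancel₀ _ hq.ne'] at h3
      linarith
    · have := mul_nonneg (div_nonneg hz' hq.le) (hQ0 x)
      linarith [not_le.1 hx]

theorem one_sub_inner_nonneg {d : ℕ} (ξ ξ' : USphere d) : 0 ≤ 1 - ⟪(ξ : Euc d), (ξ' : Euc d)⟫ := by
  have := real_inner_le_norm (ξ : Euc d) (ξ' : Euc d)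
  simp only [norm_eq_of_mem_sphere, mul_one] at this
  linarith

theorem eq_of_one_sub_inner_eq_zero {d : ℕ} {ξ ξ' : USphere d}
    (h : 1 - ⟪(ξ : Euc d), (ξ' : Euc d)⟫ = 0) : ξ = ξ' :=
  Subtype.ext ((inner_eq_one_iff_of_norm_eq_one (𝕜 := ℝ) (by simp) (by simp)).1 (by linarith))

omit [NeZero d] in
/-- Near any point of the domain the hull is approximated from below by an affine minorant. -/
theorem exists_affineMinorant_near (hΩb : Bornology.IsBounded Ω) {f : IntegrandDomain Ω d → ℝ}
    (hf : Continuous f)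
    (hf0 : ∀ x : closure Ω, ∀ ξ ζ ξ' ζ' : USphere d, f (x, 0, ξ, ζ) = f (x, 0, ξ', ζ'))
    (hf1 : ∀ x : closure Ω, ∀ ξ ζ ξ' ζ' : USphere d, f (x, 1, ξ, ζ) = f (x, 1, ξ', ζ'))
    (p₀ : IntegrandDomain Ω d) {ε : ℝ} (hε : 0 < ε) :
    ∃ L : IntegrandDomain Ω d → ℝ, IsAffineMinorant (f ∘ toIntegrandDomain)
      (L ∘ toIntegrandDomain) ∧ ∀ᶠ p in 𝓝 p₀, hullInRatio f p - ε ≤ L p := by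
  have : CompactSpace (closure Ω) := isCompact_iff_compactSpace.1 hΩb.isCompact_closure
  obtain ⟨x₀, t₀, ξ₀, ζ₀⟩ := p₀
  set Q : IntegrandDomain Ω d → ℝ := fun p => dist p.1 x₀ +
    p.2.1 * (1 - ⟪(p.2.2.1 : Euc d), (ξ₀ : Euc d)⟫) +
    (1 - p.2.1) * (1 - ⟪(p.2.2.2 : Euc d), (ζ₀ : Euc d)⟫) with hQdef
  have hQc : Continuous Q := by simp only [hQdef]; fun_prop
  have hQ1 : ∀ p : IntegrandDomain Ω d, 0 ≤ (p.2.1 : ℝ) * (1 - ⟪(p.2.2.1 : Euc d), (ξ₀ : Euc d)⟫) :=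
    fun p => mul_nonneg p.2.1.2.1 (one_sub_inner_nonneg _ _)
  have hQ2 : ∀ p : IntegrandDomain Ω d,
      0 ≤ (1 - (p.2.1 : ℝ)) * (1 - ⟪(p.2.2.2 : Euc d), (ζ₀ : Euc d)⟫) :=
    fun p => mul_nonneg (sub_nonneg.2 p.2.1.2.2) (one_sub_inner_nonneg _ _)
  have hQ0 : ∀ p, 0 ≤ Q p := fun p =>
    add_nonneg (add_nonneg dist_nonneg (hQ1 p)) (hQ2 p)
  obtain ⟨C, hC0, hC⟩ := exists_penalty (D := fun p => f (x₀, p.2.1, ξ₀, ζ₀) - f p) (Q := Q)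
    (by fun_prop) hQc hQ0 (fun p hp => by
      obtain ⟨x, t, ξ, ζ⟩ := p
      have q1 := hQ1 (x, t, ξ, ζ)
      have q2 := hQ2 (x, t, ξ, ζ)
      simp only [hQdef] at hp q1 q2
      have hd : dist x x₀ = 0 := le_antisymm (by linarith) dist_nonneg
      have z1 : (t : ℝ) * (1 - ⟪(ξ : Euc d), (ξ₀ : Euc d)⟫) = 0 := by linarith [hd]
      have z2 : (1 - (t : ℝ)) * (1 - ⟪(ζ : Euc d), (ζ₀ : Euc d)⟫) = 0 := by linarith [hd]
      obtain rfl := dist_eq_zero.1 hd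
      rcases mul_eq_zero.1 z1 with ht | h1
      · obtain rfl : t = 0 := Subtype.ext ht
        exact (sub_eq_zero.2 (hf0 x _ _ _ _)).le
      · rcases mul_eq_zero.1 z2 with ht | h2
        · obtain rfl : t = 1 := Subtype.ext (by simpa using (sub_eq_zero.1 ht).symm)
          exact (sub_eq_zero.2 (hf1 x _ _ _ _)).le
        · rw [eq_of_one_sub_inner_eq_zero h1, eq_of_one_sub_inner_eq_zero h2]
          simp) (half_pos (half_pos hε))
  obtain ⟨α, β, hαβ, hlt⟩ := (lscConvexHull_duality (ratioSection hf (x₀, t₀, ξ₀, ζ₀)) t₀).2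
    (hullInRatio f (x₀, t₀, ξ₀, ζ₀) - ε / 2) (by
      show lscConvexHull _ t₀ - ε / 2 < lscConvexHull _ t₀
      exact sub_lt_self _ (half_pos hε))
  set L : IntegrandDomain Ω d → ℝ := fun p =>
    α * p.2.1 + β * (1 - p.2.1) - ε / 2 / 2 - C * Q p with hL
  have hLc : Continuous L := by simp only [hL]; fun_prop
  refine ⟨L, ?_, ?_⟩
  · obtain ⟨R, hR⟩ := (isCompact_univ.image (by fun_prop :
      Continuous fun x : closure Ω => dist x x₀)).isBounded.exists_norm_le
    have hR' : ∀ x : Ω, |dist (toClosure x) x₀| ≤ R := fun x => hR _ ⟨toClosure x, trivial, rfl⟩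
    refine ⟨fun x => α - ε / 2 / 2 - C * dist (toClosure x) x₀ - C,
      fun x => β - ε / 2 / 2 - C * dist (toClosure x) x₀ - C,
      fun x => C • (ξ₀ : Euc d), fun x => C • (ζ₀ : Euc d),
      |α| + |β| + ε / 2 / 2 + C * |R| + C, ⟨?_, ?_, by fun_prop, by fun_prop⟩, fun x => ?_, ?_, ?_⟩
    · have : Continuous (toClosure : Ω → closure Ω) := continuous_inclusion subset_closure
      fun_prop
    · have : Continuous (toClosure : Ω → closure Ω) := continuous_inclusion subset_closure
      fun_prop
    · have hx := hR' x
      rw [abs_of_nonneg dist_nonneg] at hx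
      have hx' : C * dist (toClosure x) x₀ ≤ C * |R| :=
        mul_le_mul_of_nonneg_left (hx.trans (le_abs_self R)) hC0
      have hx'' : 0 ≤ C * dist (toClosure x) x₀ := mul_nonneg hC0 dist_nonneg
      have hn : ∀ ξ : USphere d, ‖C • (ξ : Euc d)‖ = C := fun ξ => by
        simp [norm_smul, abs_of_nonneg hC0]
      have hCR := mul_nonneg hC0 (abs_nonneg R)
      rw [hn, hn]
      have a1 := abs_nonneg α
      have a2 := abs_nonneg β
      refine ⟨abs_le.2 ⟨?_, ?_⟩, abs_le.2 ⟨?_, ?_⟩, ?_, ?_⟩ <;>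
        linarith [le_abs_self α, neg_abs_le α, le_abs_self β, neg_abs_le β]
    · ext p
      simp only [Function.comp, hL, hQdef, affineIntegrand, toIntegrandDomain, inner_smul_left,
        conj_trivial, real_inner_comm]
      ring
    · intro p
      have h1 := hC (toIntegrandDomain p)
      have h2 := hαβ p.2.1
      have h3 : ratioSection hf (x₀, t₀, ξ₀, ζ₀) p.2.1 =
        f (x₀, (toIntegrandDomain p).2.1, ξ₀, ζ₀) := rfl
      rw [h3] at h2
      have h4 : (toIntegrandDomain p).2.1 = p.2.1 := rfl
      simp only [Function.comp, hL]
      rw [h4] at *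
      linarith
  · have hL0 : hullInRatio f (x₀, t₀, ξ₀, ζ₀) - ε < L (x₀, t₀, ξ₀, ζ₀) := by
      have : Q (x₀, t₀, ξ₀, ζ₀) = 0 := by simp [hQdef]
      simp only [hL, this]
      linarith
    have hcont : Continuous fun p => hullInRatio f p - ε := (continuous_hullInRatio hf).sub continuous_const
    filter_upwards [hcont.continuousAt.eventually_lt hLc.continuousAt hL0] with p hp using hp.le

theorem exists_affineMinorant_integral_gt (hΩ : IsOpen Ω) (hΩb : Bornology.IsBounded Ω)
    {f : IntegrandDomain Ω d → ℝ} (hf : Continuous f)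
    (hf0 : ∀ x : closure Ω, ∀ ξ ζ ξ' ζ' : USphere d, f (x, 0, ξ, ζ) = f (x, 0, ξ', ζ'))
    (hf1 : ∀ x : closure Ω, ∀ ξ ζ ξ' ζ' : USphere d, f (x, 1, ξ, ζ) = f (x, 1, ξ', ζ'))
    (hi : Integrable (measIntegrand (hullInRatio f) μ ν) (μ.variation + ν.variation))
    {y : ℝ} (hy : y < measFunctional (hullInRatio f) μ ν) :
    ∃ ℓ, IsAffineMinorant (f ∘ toIntegrandDomain) ℓ ∧
      y < ∫ x, ℓ (polarPoint μ ν x) ∂(μ.variation + ν.variation) := by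
  have : CompactSpace (closure Ω) := isCompact_iff_compactSpace.1 hΩb.isCompact_closure
  set lam := μ.variation + ν.variation with hlam
  set m := lam.real univ with hm
  have hm0 : 0 ≤ m := measureReal_nonneg
  set ε := (measFunctional (hullInRatio f) μ ν - y) / (m + 2) with hεdef
  have hε : 0 < ε := div_pos (sub_pos.2 hy) (by linarith)
  have hεm : ε * (m + 2) = measFunctional (hullInRatio f) μ ν - y :=
    div_mul_cancel₀ _ (by linarith)
  obtain ⟨k, hk, hkle⟩ : ∃ k, IsMinorantLimit (f ∘ toIntegrandDomain) μ ν k ∧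
      ∀ x, toIntegrandDomain (polarPoint μ ν x) ∈ (univ : Set (IntegrandDomain Ω d)) →
        hullInRatio f (toIntegrandDomain (polarPoint μ ν x)) - ε ≤ k x := by
    refine isCompact_univ.induction_on (p := fun S => ∃ k,
      IsMinorantLimit (f ∘ toIntegrandDomain) μ ν k ∧
      ∀ x, toIntegrandDomain (polarPoint μ ν x) ∈ S →
        hullInRatio f (toIntegrandDomain (polarPoint μ ν x)) - ε ≤ k x) ?_ ?_ ?_ ?_
    · rcases isEmpty_or_nonempty (IntegrandDomain Ω d) with he | ⟨⟨p₀⟩⟩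
      · refine ⟨0, ⟨integrable_zero _ _ _, fun ε' hε' => ⟨affineIntegrand 0 0 0 0, ⟨0, 0, 0, 0, 0,
          ⟨continuous_zero, continuous_zero, continuous_zero, continuous_zero⟩, by simp, rfl,
          fun p => (he.false (toIntegrandDomain p)).elim⟩, ?_⟩⟩, by simp⟩
        have : (fun x => |affineIntegrand 0 0 0 0 (polarPoint μ ν x) - (0 : Ω → ℝ) x|) = 0 := by
          ext x; exact (he.false (toIntegrandDomain (polarPoint μ ν x))).elim
        rw [this]
        simpa using hε'.le
      · obtain ⟨L, hL, -⟩ := exists_affineMinorant_near hΩb hf hf0 hf1 p₀ hε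
        exact ⟨_, hL.isMinorantLimit, by simp⟩
    · rintro S S' hSS' ⟨k, hk, h⟩
      exact ⟨k, hk, fun x hx => h x (hSS' hx)⟩
    · rintro S S' ⟨k, hk, h⟩ ⟨k', hk', h'⟩
      refine ⟨_, hk.sup hΩ hk', fun x hx => ?_⟩
      rcases hx with hx | hx
      · exact (h x hx).trans (le_max_left _ _)
      · exact (h' x hx).trans (le_max_right _ _)
    · intro p₀ _
      obtain ⟨L, hL, hnear⟩ := exists_affineMinorant_near hΩb hf hf0 hf1 p₀ hε
      exact ⟨_, mem_nhdsWithin_of_mem_nhds hnear, _, hL.isMinorantLimit, fun x hx => hx⟩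
  obtain ⟨ℓ, hℓ, hℓk⟩ := hk.2 ε hε
  refine ⟨ℓ, hℓ, ?_⟩
  have h1 : ∫ x, (measIntegrand (hullInRatio f) μ ν x - ε) ∂lam ≤ ∫ x, k x ∂lam :=
    integral_mono (hi.sub (integrable_const _)) hk.1 fun x => hkle x trivial
  have h2 : ∫ x, k x ∂lam - ∫ x, ℓ (polarPoint μ ν x) ∂lam ≤ ε := by
    rw [← integral_sub hk.1 hℓ.integrable]
    refine (integral_mono (hk.1.sub hℓ.integrable) (hℓ.integrable.sub hk.1).abs fun x => ?_).trans hℓk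
    simp only [Pi.sub_apply]
    rw [abs_sub_comm]
    exact le_abs_self _
  rw [integral_sub hi (integrable_const _), integral_const, smul_eq_mul] at h1
  have h3 : measFunctional (hullInRatio f) μ ν = ∫ x, measIntegrand (hullInRatio f) μ ν x ∂lam := rfl
  rw [← h3, ← hm] at h1
  nlinarith

theorem integrable_measIntegrand_hullInRatio (hΩb : Bornology.IsBounded Ω)
    {f : IntegrandDomain Ω d → ℝ} (hf : Continuous f) :
    Integrable (measIntegrand (hullInRatio f) μ ν) (μ.variation + ν.variation) := by
  have : CompactSpace (closure Ω) := isCompact_iff_compactSpace.1 hΩb.isCompact_closure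
  have hc := continuous_hullInRatio hf
  obtain ⟨C, hC⟩ := (isCompact_range hc).isBounded.exists_norm_le
  exact Integrable.of_bound ((hc.comp continuous_toIntegrandDomain).measurable.comp
    (measurable_polarPoint μ ν)).aestronglyMeasurable C (.of_forall fun x => hC _ ⟨_, rfl⟩)

end LowerBound

section Discretization

/-- A measurable map into a compact metric space is uniformly approximated by its values at
finitely many points, chosen by a simple function of the source. -/
theorem exists_simpleFunc_dist_lt {X K : Type*} [MeasurableSpace X] [MetricSpace K]
    [CompactSpace K] [MeasurableSpace K] [BorelSpace K] {G : X → K} (hG : Measurable G) {ε : ℝ}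
    (hε : 0 < ε) : ∃ π : SimpleFunc X X, ∀ x, dist (G (π x)) (G x) < ε := by
  classical
  rcases isEmpty_or_nonempty X with he | hne
  · exact ⟨SimpleFunc.ofIsEmpty, fun x => he.elim x⟩
  have : Nonempty K := hne.map G
  set e := TopologicalSpace.denseSeq K
  have hcov : (univ : Set K) ⊆ ⋃ N : ℕ, ⋃ j ≤ N, Metric.ball (e j) (ε / 2) := by
    intro k _
    obtain ⟨j, hj⟩ := (TopologicalSpace.denseRange_denseSeq K).exists_dist_lt k (half_pos hε)
    exact mem_iUnion.2 ⟨j, mem_iUnion₂.2 ⟨j, le_rfl, hj⟩⟩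
  obtain ⟨N, hN⟩ := isCompact_univ.elim_directed_cover _
    (fun N => isOpen_biUnion fun j _ => Metric.isOpen_ball) hcov
    (directed_of_isDirected_le fun M N hMN => biUnion_subset_biUnion_left fun j hj =>
      le_trans hj hMN)
  set q := SimpleFunc.nearestPt e N
  have hq : ∀ k, dist (q k) k < ε / 2 := by
    intro k
    obtain ⟨j, hj, hjk⟩ := mem_iUnion₂.1 (hN (mem_univ k))
    have h1 : edist (q k) k ≤ edist (e j) k := SimpleFunc.edist_nearestPt_le e k hj
    rw [edist_dist, edist_dist, ENNReal.ofReal_le_ofReal_iff dist_nonneg] at h1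
    exact h1.trans_lt (by rwa [Metric.mem_ball, dist_comm] at hjk)
  let r : K → X := fun c => if h : ∃ x, q (G x) = c then h.choose else Classical.arbitrary X
  have hr : ∀ x, q (G (r (q (G x)))) = q (G x) := by
    intro x
    have h : ∃ x', q (G x') = q (G x) := ⟨x, rfl⟩
    simp only [r, dif_pos h]
    exact h.choose_spec
  refine ⟨(q.comp G hG).map r, fun x => ?_⟩
  have h1 := hq (G (r (q (G x))))
  rw [hr] at h1
  have h2 := hq (G x)
  calc dist (G (r (q (G x)))) (G x) ≤ dist (q (G x)) (G (r (q (G x)))) + dist (q (G x)) (G x) :=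
        dist_triangle_left _ _ _
    _ < ε := by linarith

theorem integral_comp_simpleFunc {X Y : Type*} [MeasurableSpace X] (m : Measure X)
    [IsFiniteMeasure m] (π : SimpleFunc X Y) (h : Y → ℝ) :
    ∫ x, h (π x) ∂m = ∑ y ∈ π.range, m.real (π ⁻¹' {y}) * h y := by
  classical
  have e : ∀ x, h (π x) = ∑ y ∈ π.range, (π ⁻¹' {y}).indicator (fun _ => h y) x := by
    intro x
    rw [Finset.sum_eq_single_of_mem (π x) (π.mem_range_self x)]
    · simp
    · intro y _ hy
      exact indicator_of_notMem (fun hx => hy hx.symm) _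
  simp_rw [e]
  rw [integral_finsetSum _ fun y _ => (integrable_const _).indicator (π.measurableSet_fiber y)]
  refine Finset.sum_congr rfl fun y _ => ?_
  rw [integral_indicator (π.measurableSet_fiber y), setIntegral_const, smul_eq_mul]

end Discretization

section Lebesgue

variable {n : ℕ} {Ω : Set (Euc n)}

theorem leb_apply (hΩ : IsOpen Ω) (s : Set Ω) : leb Ω s = volume ((↑) '' s : Set (Euc n)) :=
  (MeasurableEmbedding.subtype_coe hΩ.measurableSet).comap_apply _ _

theorem isFiniteMeasure_leb (hΩ : IsOpen Ω) (hΩb : Bornology.IsBounded Ω) :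
    IsFiniteMeasure (leb Ω) := by
  refine ⟨?_⟩
  rw [leb_apply hΩ, image_univ, Subtype.range_coe]
  exact hΩb.measure_lt_top

theorem leb_pos_of_isOpen (hΩ : IsOpen Ω) {s : Set Ω} (hs : IsOpen s) (hne : s.Nonempty) :
    0 < leb Ω s := by
  rw [leb_apply hΩ]
  exact (hΩ.isOpenMap_subtype_val s hs).measure_pos _ (hne.image _)

theorem exists_disjoint_near [NeZero n] (hΩ : IsOpen Ω) {J : Type*} [Fintype J] (y : J → Ω) {ε : ℝ}
    (hε : 0 < ε) : ∃ B : J → Set Ω, (∀ j, IsOpen (B j)) ∧ Pairwise (Function.onFun Disjoint B) ∧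
      (∀ j, 0 < leb Ω (B j)) ∧ ∀ j, ∀ x ∈ B j, dist x (y j) < ε := by
  classical
  have hinf : ∀ j, (Metric.ball (y j) (ε / 2)).Infinite := by
    intro j hfin
    have h1 := leb_pos_of_isOpen hΩ Metric.isOpen_ball (Metric.nonempty_ball.2 (half_pos hε)
      : (Metric.ball (y j) (ε / 2)).Nonempty)
    rw [leb_apply hΩ, (hfin.image _).measure_zero] at h1
    exact lt_irrefl _ h1
  choose t ht htc using fun j => (hinf j).exists_subset_card_eq (Fintype.card J)
  obtain ⟨z, hz, hzt⟩ := (Finset.all_card_le_biUnion_card_iff_exists_injective t).1 (by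
    intro s
    rcases s.eq_empty_or_nonempty with rfl | ⟨j, hj⟩
    · simp
    · calc s.card ≤ Fintype.card J := s.card_le_univ
        _ = (t j).card := (htc j).symm
        _ ≤ _ := Finset.card_le_card (Finset.subset_biUnion_of_mem t hj))
  obtain ⟨U, hU, hUd⟩ := (finite_range z).t2_separation
  have hzy : ∀ j, dist (z j) (y j) < ε / 2 := fun j => ht j (hzt j)
  refine ⟨fun j => U (z j) ∩ Metric.ball (z j) (ε / 2), fun j => (hU _).2.inter Metric.isOpen_ball,
    fun i j hij => ?_, fun j => ?_, fun j x hx => ?_⟩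
  · exact (hUd ⟨i, rfl⟩ ⟨j, rfl⟩ (hz.ne hij)).mono inter_subset_left inter_subset_left
  · exact leb_pos_of_isOpen hΩ ((hU _).2.inter Metric.isOpen_ball)
      ⟨z j, (hU _).1, Metric.mem_ball_self (half_pos hε)⟩
  · have := dist_triangle x (z j) (y j)
    have h2 : dist x (z j) < ε / 2 := hx.2
    linarith [hzy j]

end Lebesgue

section Recovery

variable {n d : ℕ} {Ω : Set (Euc n)}

/-- At ratio `0` the integrand does not depend on the first direction, and at ratio `1` not on
the second one. -/
def IgnoresVanishing (g : OpenDomain Ω d → ℝ) : Prop :=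
  (∀ x ξ ξ' ζ, g (x, 0, ξ, ζ) = g (x, 0, ξ', ζ)) ∧ ∀ x ξ ζ ζ', g (x, 1, ξ, ζ) = g (x, 1, ξ, ζ')

variable [NeZero d]

theorem IgnoresVanishing.density_eq {g : OpenDomain Ω d → ℝ} (hg : IgnoresVanishing g) (x : Ω)
    (s : Icc (0 : ℝ) 1) (ξ ζ : USphere d) {c : ℝ} (hc : 0 ≤ c) :
    g (x, massRatio ((c * s) • (ξ : Euc d)) ((c * (1 - s)) • (ζ : Euc d)),
      unitDir ((c * s) • (ξ : Euc d)), unitDir ((c * (1 - s)) • (ζ : Euc d))) *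
      (‖(c * s) • (ξ : Euc d)‖ + ‖(c * (1 - s)) • (ζ : Euc d)‖) = c * g (x, s, ξ, ζ) := by
  have hs0 : 0 ≤ (s : ℝ) := s.2.1
  have hs1 : 0 ≤ 1 - (s : ℝ) := sub_nonneg.2 s.2.2
  have n1 : ‖(c * s) • (ξ : Euc d)‖ = c * s := by
    rw [norm_smul, norm_eq_of_mem_sphere, mul_one, Real.norm_of_nonneg (by positivity)]
  have n2 : ‖(c * (1 - s)) • (ζ : Euc d)‖ = c * (1 - s) := by
    rw [norm_smul, norm_eq_of_mem_sphere, mul_one, Real.norm_of_nonneg (by positivity)]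
  have hsum : c * (s : ℝ) + c * (1 - s) = c := by ring
  rcases hc.eq_or_lt with rfl | hc
  · rw [n1, n2, hsum]; simp
  have hmr : massRatio ((c * s) • (ξ : Euc d)) ((c * (1 - s)) • (ζ : Euc d)) = s := by
    apply Subtype.ext
    show ‖_‖ / (‖_‖ + ‖_‖) = _
    rw [n1, n2, hsum, mul_div_cancel_left₀ _ hc.ne']
  rw [n1, n2, hsum, hmr, mul_comm]
  congr 1
  rcases hs0.eq_or_lt with h | h
  · obtain rfl : s = 0 := Subtype.ext h.symm
    rw [unitDir_smul (by simpa using hc) ζ]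
    exact hg.1 _ _ _ _
  · rw [unitDir_smul (mul_pos hc h) ξ]
    rcases hs1.eq_or_lt with h' | h'
    · obtain rfl : s = 1 := Subtype.ext (show (s : ℝ) = 1 by linarith)
      exact hg.2 _ _ _ _
    · rw [unitDir_smul (mul_pos hc h') ζ]

/-- Finitely many weighted atoms are approximated by a pair of integrable functions. -/
theorem exists_pair_near_atoms [NeZero n] (hΩ : IsOpen Ω) (hΩb : Bornology.IsBounded Ω)
    {J : Type*} [Fintype J] (m : J → ℝ) (hm : ∀ j, 0 ≤ m j) (p : J → OpenDomain Ω d) {ε : ℝ}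
    (hε : 0 < ε) : ∃ u v : Lp (Euc d) 1 (leb Ω), ∀ g : OpenDomain Ω d → ℝ, Continuous g →
      (∃ C, ∀ q, |g q| ≤ C) → IgnoresVanishing g →
      ∀ δ, (∀ q q', dist q q' < ε → |g q - g q'| ≤ δ) →
        |∫ x, pairDensity g u v x ∂(leb Ω) - ∑ j, m j * g (p j)| ≤ δ * ∑ j, m j := by
  classical
  have := isFiniteMeasure_leb hΩ hΩb
  obtain ⟨B, hBo, hBd, hBpos, hBy⟩ := exists_disjoint_near hΩ (fun j => (p j).1) hε
  have hBr : ∀ j, 0 < (leb Ω).real (B j) := fun j =>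
    ENNReal.toReal_pos (hBpos j).ne' (measure_ne_top _ _)
  set c : J → ℝ := fun j => m j / (leb Ω).real (B j) with hc
  have hc0 : ∀ j, 0 ≤ c j := fun j => div_nonneg (hm j) (hBr j).le
  have hcm : ∀ j, c j * (leb Ω).real (B j) = m j := fun j => div_mul_cancel₀ _ (hBr j).ne'
  set u₀ : Ω → Euc d := fun x => ∑ j, (B j).indicator
    (fun _ => (c j * (p j).2.1) • ((p j).2.2.1 : Euc d)) x with hu₀
  set v₀ : Ω → Euc d := fun x => ∑ j, (B j).indicator
    (fun _ => (c j * (1 - (p j).2.1)) • ((p j).2.2.2 : Euc d)) x with hv₀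
  have hui : Integrable u₀ (leb Ω) := integrable_finsetSum _ fun j _ =>
    (integrable_const _).indicator (hBo j).measurableSet
  have hvi : Integrable v₀ (leb Ω) := integrable_finsetSum _ fun j _ =>
    (integrable_const _).indicator (hBo j).measurableSet
  have hsum : ∀ {E : Type} [AddCommMonoid E] (k : J → Ω → E) (i : J) (x : Ω), x ∈ B i →
      ∑ j, (B j).indicator (k j) x = k i x := by
    intro E _ k i x hx
    rw [Finset.sum_eq_single_of_mem i (Finset.mem_univ i), indicator_of_mem hx]
    intro j _ hji
    exact indicator_of_notMem (fun hxj => disjoint_left.1 (hBd hji) hxj hx) _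
  have hsum0 : ∀ {E : Type} [AddCommMonoid E] (k : J → Ω → E) (x : Ω), (∀ j, x ∉ B j) →
      ∑ j, (B j).indicator (k j) x = 0 := by
    intro E _ k x hx
    exact Finset.sum_eq_zero fun j _ => indicator_of_notMem (hx j) _
  refine ⟨hui.toL1 u₀, hvi.toL1 v₀, fun g hg hgb hgv δ hδ => ?_⟩
  obtain ⟨C, hC⟩ := hgb
  have hpt : ∀ᵐ x ∂(leb Ω), pairDensity g (hui.toL1 u₀) (hvi.toL1 v₀) x =
      ∑ j, (B j).indicator (fun x => c j * g (x, (p j).2)) x := by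
    filter_upwards [hui.coeFn_toL1, hvi.coeFn_toL1] with x hx1 hx2
    rw [pairDensity, hx1, hx2]
    by_cases hx : ∃ i, x ∈ B i
    · obtain ⟨i, hi⟩ := hx
      have e1 : u₀ x = (c i * (p i).2.1) • ((p i).2.2.1 : Euc d) := hsum _ i x hi
      have e2 : v₀ x = (c i * (1 - (p i).2.1)) • ((p i).2.2.2 : Euc d) := hsum _ i x hi
      rw [e1, e2, hsum _ i x hi]
      exact hgv.density_eq x _ _ _ (hc0 i)
    · have hx' : ∀ j, x ∉ B j := fun j hj => hx ⟨j, hj⟩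
      have e1 : u₀ x = 0 := hsum0 _ x hx'
      have e2 : v₀ x = 0 := hsum0 _ x hx'
      rw [e1, e2, hsum0 _ x hx']
      simp
  have hgi : ∀ j, Integrable (fun x => c j * g (x, (p j).2)) (leb Ω) := fun j =>
    (integrable_of_continuous_of_bound _ (by fun_prop) (C := C) fun x => hC _).const_mul _
  rw [integral_congr_ae hpt, integral_finsetSum _ fun j _ =>
    (hgi j).indicator (hBo j).measurableSet, ← Finset.sum_sub_distrib, Finset.mul_sum]
  refine (Finset.abs_sum_le_sum_abs _ _).trans (Finset.sum_le_sum fun j _ => ?_)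
  rw [integral_indicator (hBo j).measurableSet]
  have e : ∫ x in B j, c j * g (x, (p j).2) ∂(leb Ω) - m j * g (p j) =
      ∫ x in B j, (c j * g (x, (p j).2) - c j * g (p j)) ∂(leb Ω) := by
    rw [integral_sub (hgi j).integrableOn (integrable_const _), setIntegral_const, smul_eq_mul,
      ← hcm j]
    ring
  rw [e]
  have hbound := norm_setIntegral_le_of_norm_le_const (μ := leb Ω) (s := B j) (C := c j * δ)
    (f := fun x => c j * g (x, (p j).2) - c j * g (p j)) (measure_lt_top _ _) (fun x hx => by
      rw [← mul_sub, norm_mul, Real.norm_of_nonneg (hc0 j)]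
      refine mul_le_mul_of_nonneg_left (hδ _ _ ?_) (hc0 j)
      have := hBy j x hx
      rw [Prod.dist_eq, dist_self, max_lt_iff]
      exact ⟨this, hε⟩)
  rw [Real.norm_eq_abs] at hbound
  refine hbound.trans (le_of_eq ?_)
  rw [← hcm j]; ring

variable (μ ν : RadonVec Ω d)

theorem exists_pair_near [NeZero n] (hΩ : IsOpen Ω) (hΩb : Bornology.IsBounded Ω)
    {ι : Ω → Type} [∀ x, Fintype (ι x)] (w : ∀ x, ι x → ℝ) (s : ∀ x, ι x → Icc (0 : ℝ) 1)
    (hw : ∀ x i, 0 ≤ w x i) (hw1 : ∀ x, ∑ i, w x i = 1) {ε : ℝ} (hε : 0 < ε) :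
    ∃ u v : Lp (Euc d) 1 (leb Ω), ∀ g k : OpenDomain Ω d → ℝ, Continuous g →
      (∃ C, ∀ q, |g q| ≤ C) → IgnoresVanishing g → Continuous k → (∃ C, ∀ q, |k q| ≤ C) →
      (∀ x, ∑ i, w x i * g (x, s x i, polarDir μ x, polarDir ν x) = k (polarPoint μ ν x)) →
      ∀ δ, (∀ q q', dist q q' < ε → |g q - g q'| ≤ δ) →
        (∀ q q', dist q q' < ε → |k q - k q'| ≤ δ) →
        |∫ x, pairDensity g u v x ∂(leb Ω) -
          ∫ x, k (polarPoint μ ν x) ∂(μ.variation + ν.variation)| ≤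
            2 * δ * (μ.variation + ν.variation).real univ := by
  have : CompactSpace (closure Ω) := isCompact_iff_compactSpace.1 hΩb.isCompact_closure
  obtain ⟨π, hπ⟩ := exists_simpleFunc_dist_lt (G := fun x => toIntegrandDomain (polarPoint μ ν x))
    (continuous_toIntegrandDomain.measurable.comp (measurable_polarPoint μ ν)) hε
  set m := μ.variation + ν.variation
  obtain ⟨u, v, huv⟩ := exists_pair_near_atoms hΩ hΩb (J := Σ y : π.range, ι y.1)
    (fun j => m.real (π ⁻¹' {j.1.1}) * w j.1.1 j.2)
    (fun j => mul_nonneg measureReal_nonneg (hw _ _))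
    (fun j => (j.1.1, s j.1.1 j.2, polarDir μ j.1.1, polarDir ν j.1.1)) hε
  refine ⟨u, v, fun g k hg hgb hgv hk hkb hgk δ hδg hδk => ?_⟩
  have h1 := huv g hg hgb hgv δ hδg
  have hmass : ∑ j : (Σ y : π.range, ι y.1), m.real (π ⁻¹' {j.1.1}) * w j.1.1 j.2 =
      m.real univ := by
    rw [Fintype.sum_sigma]
    simp_rw [← Finset.mul_sum, hw1]
    have := integral_comp_simpleFunc m π (fun _ => 1)
    rw [integral_const, smul_eq_mul, mul_one] at this
    rw [this]
    exact Finset.sum_coe_sort π.range fun y => m.real (π ⁻¹' {y}) * 1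
  have hval : ∑ j : (Σ y : π.range, ι y.1), m.real (π ⁻¹' {j.1.1}) * w j.1.1 j.2 *
      g (j.1.1, s j.1.1 j.2, polarDir μ j.1.1, polarDir ν j.1.1) =
      ∫ x, k (polarPoint μ ν (π x)) ∂m := by
    rw [Fintype.sum_sigma, integral_comp_simpleFunc m π fun y => k (polarPoint μ ν y)]
    simp_rw [mul_assoc, ← Finset.mul_sum, hgk]
    exact Finset.sum_coe_sort π.range fun y => m.real (π ⁻¹' {y}) * k (polarPoint μ ν y)
  rw [hmass, hval] at h1
  obtain ⟨C, hC⟩ := hkb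
  have hmeas : Measurable fun x => k (polarPoint μ ν x) :=
    hk.measurable.comp (measurable_polarPoint μ ν)
  have i1 : Integrable (fun x => k (polarPoint μ ν (π x))) m :=
    Integrable.of_bound (hmeas.comp π.measurable).aestronglyMeasurable C (.of_forall fun x => hC _)
  have i2 : Integrable (fun x => k (polarPoint μ ν x)) m :=
    Integrable.of_bound hmeas.aestronglyMeasurable C (.of_forall fun x => hC _)
  have h2 : |∫ x, k (polarPoint μ ν (π x)) ∂m - ∫ x, k (polarPoint μ ν x) ∂m| ≤
      δ * m.real univ := by
    rw [← integral_sub i1 i2]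
    have hb : ∀ x, ‖k (polarPoint μ ν (π x)) - k (polarPoint μ ν x)‖ ≤ δ := fun x =>
      hδk _ _ (by rw [← isometry_toIntegrandDomain.dist_eq]; exact hπ x)
    exact norm_integral_le_of_norm_le_const (.of_forall hb)
  have h3 := abs_sub_le (∫ x, pairDensity g u v x ∂(leb Ω)) (∫ x, k (polarPoint μ ν (π x)) ∂m)
    (∫ x, k (polarPoint μ ν x) ∂m)
  linarith

theorem exists_pair_sequence [NeZero n] (hΩ : IsOpen Ω) (hΩb : Bornology.IsBounded Ω)
    {ι : Ω → Type} [∀ x, Fintype (ι x)] (w : ∀ x, ι x → ℝ) (s : ∀ x, ι x → Icc (0 : ℝ) 1)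
    (hw : ∀ x i, 0 ≤ w x i) (hw1 : ∀ x, ∑ i, w x i = 1) :
    ∃ u v : ℕ → Lp (Euc d) 1 (leb Ω), ∀ g k : OpenDomain Ω d → ℝ, UniformContinuous g →
      (∃ C, ∀ q, |g q| ≤ C) → IgnoresVanishing g → UniformContinuous k → (∃ C, ∀ q, |k q| ≤ C) →
      (∀ x, ∑ i, w x i * g (x, s x i, polarDir μ x, polarDir ν x) = k (polarPoint μ ν x)) →
      Tendsto (fun j => ∫ x, pairDensity g (u j) (v j) x ∂(leb Ω)) atTop
        (𝓝 (∫ x, k (polarPoint μ ν x) ∂(μ.variation + ν.variation))) := by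
  choose u v huv using fun j : ℕ => exists_pair_near μ ν hΩ hΩb w s hw hw1
    (Nat.one_div_pos_of_nat (α := ℝ) (n := j))
  refine ⟨u, v, fun g k hg hgb hgv hk hkb hgk => ?_⟩
  rw [Metric.tendsto_atTop]
  intro ε hε
  set M := (μ.variation + ν.variation).real univ
  have hM : 0 ≤ M := measureReal_nonneg
  set δ := ε / (2 * (M + 1)) with hδ
  have hδ0 : 0 < δ := by positivity
  have hδM : 2 * δ * M < ε := by
    have : 2 * δ * (M + 1) = ε := by rw [hδ]; field_simp
    linarith
  obtain ⟨r₁, hr₁, h₁⟩ := Metric.uniformContinuous_iff.1 hg δ hδ0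
  obtain ⟨r₂, hr₂, h₂⟩ := Metric.uniformContinuous_iff.1 hk δ hδ0
  obtain ⟨N, hN⟩ := exists_nat_one_div_lt (lt_min hr₁ hr₂)
  refine ⟨N, fun j hj => ?_⟩
  have hjr : (1 : ℝ) / (j + 1) < min r₁ r₂ := by
    refine lt_of_le_of_lt ?_ hN
    gcongr
  rw [Real.dist_eq]
  refine (huv j g k hg.continuous hgb hgv hk.continuous hkb hgk δ (fun q q' hq => ?_)
    fun q q' hq => ?_).trans_lt hδM
  · exact (h₁ (hq.trans (hjr.trans_le (min_le_left _ _)))).le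
  · exact (h₂ (hq.trans (hjr.trans_le (min_le_right _ _)))).le

end Recovery

section Relaxation

theorem uniformContinuous_mul_of_bounded {X : Type*} [PseudoMetricSpace X] {g k : X → ℝ}
    (hg : UniformContinuous g) (hk : UniformContinuous k) {C : ℝ} (hgC : ∀ x, |g x| ≤ C)
    (hkC : ∀ x, |k x| ≤ C) : UniformContinuous fun x => g x * k x := by
  rw [Metric.uniformContinuous_iff]
  intro ε hε
  obtain ⟨r₁, hr₁, h₁⟩ := Metric.uniformContinuous_iff.1 hg (ε / (2 * (|C| + 1))) (by positivity)
  obtain ⟨r₂, hr₂, h₂⟩ := Metric.uniformContinuous_iff.1 hk (ε / (2 * (|C| + 1))) (by positivity)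
  refine ⟨min r₁ r₂, lt_min hr₁ hr₂, fun x y hxy => ?_⟩
  have i₁ := h₁ (hxy.trans_le (min_le_left _ _))
  have i₂ := h₂ (hxy.trans_le (min_le_right _ _))
  rw [Real.dist_eq] at i₁ i₂ ⊢
  have hC : 0 < |C| + 1 := by positivity
  have b₁ : |g x| ≤ |C| + 1 := (hgC x).trans (by linarith [le_abs_self C])
  have b₂ : |k y| ≤ |C| + 1 := (hkC y).trans (by linarith [le_abs_self C])
  calc |g x * k x - g y * k y| = |g x * (k x - k y) + k y * (g x - g y)| := by ring_nf
    _ ≤ |g x| * |k x - k y| + |k y| * |g x - g y| := by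
        rw [← abs_mul, ← abs_mul]; exact abs_add_le _ _
    _ ≤ (|C| + 1) * |k x - k y| + (|C| + 1) * |g x - g y| := by gcongr
    _ < (|C| + 1) * (ε / (2 * (|C| + 1))) + (|C| + 1) * (ε / (2 * (|C| + 1))) := by gcongr
    _ = ε := by field_simp; ring

variable {n d : ℕ} [NeZero d] {Ω : Set (Euc n)}

theorem weakStarTendsto_of_coordinates {u : ℕ → Lp (Euc d) 1 (leb Ω)} {μ : RadonVec Ω d}
    (h : ∀ (φ : C₀(Ω, ℝ)) (i : Fin d), Tendsto (fun k => ∫ x, φ x * u k x i ∂(leb Ω)) atTop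
      (𝓝 (∫ x, φ x * (polarDir μ x : Euc d) i ∂μ.variation))) :
    WeakStarTendsto (fun k => (leb Ω).withDensityᵥ (u k)) μ := by
  intro φ
  have hb : ∀ x, ‖φ x‖ ≤ ‖φ‖ := fun x => φ.toBCF.norm_coe_le_norm x
  have hφ : ∀ (m : Measure Ω) [IsFiniteMeasure m], Integrable φ m := fun m _ =>
    integrable_of_continuous_of_bound m (map_continuous φ) hb
  have key : ∀ (m : Measure Ω) (w : Ω → Euc d), Integrable w m →
      ∫ x, φ x • w x ∂m = WithLp.toLp 2 fun i => ∫ x, φ x * w x i ∂m := by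
    intro m w hw
    have hi : Integrable (fun x => φ x • w x) m :=
      hw.bdd_smul ‖φ‖ (map_continuous φ).aestronglyMeasurable (.of_forall hb)
    ext i
    rw [eval_integral_piLp fun j => (EuclideanSpace.proj (𝕜 := ℝ) j).integrable_comp hi]
    rfl
  have hp : Integrable (fun x => (polarDir μ x : Euc d)) μ.variation :=
    Integrable.of_bound (measurable_subtype_coe.comp
      (measurable_polarDir μ)).aestronglyMeasurable 1 (.of_forall fun x => by simp)
  rw [integral_eq_integral_polarDir μ (hφ _), key _ _ hp]
  have e : ∀ k, ((leb Ω).withDensityᵥ (u k)).integral φ (ContinuousLinearMap.lsmul ℝ ℝ) =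
      WithLp.toLp 2 fun i => ∫ x, φ x * u k x i ∂(leb Ω) := fun k => by
    rw [integral_withDensityᵥ_lsmul (integrable_coeFn_one (u k)) (hφ _),
      key _ _ (integrable_coeFn_one (u k))]
  refine Tendsto.congr (fun k => (e k).symm) ?_
  exact ((PiLp.continuous_toLp 2 _).tendsto _).comp (tendsto_pi_nhds.2 fun i => h φ i)

theorem exists_recovery_sequence [NeZero n] (hΩ : IsOpen Ω) (hΩb : Bornology.IsBounded Ω)
    {f : IntegrandDomain Ω d → ℝ} (hf : Continuous f)
    (hf0 : ∀ x : closure Ω, ∀ ξ ζ ξ' ζ' : USphere d, f (x, 0, ξ, ζ) = f (x, 0, ξ', ζ'))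
    (hf1 : ∀ x : closure Ω, ∀ ξ ζ ξ' ζ' : USphere d, f (x, 1, ξ, ζ) = f (x, 1, ξ', ζ'))
    (μ ν : RadonVec Ω d) :
    ∃ u v : ℕ → Lp (Euc d) 1 (leb Ω), StrictTendsto u μ ∧ StrictTendsto v ν ∧
      Tendsto (fun k => lebFunctional f (u k) (v k)) atTop
        (𝓝 (measFunctional (hullInRatio f) μ ν)) := by
  have : CompactSpace (closure Ω) := isCompact_iff_compactSpace.1 hΩb.isCompact_closure
  choose ι hι w s hw hw1 hws hwf using fun x : Ω => (lscConvexHull_duality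
    (ratioSection hf (toIntegrandDomain (polarPoint μ ν x))) (variationRatio μ ν x)).1
  obtain ⟨u, v, huv⟩ := exists_pair_sequence μ ν hΩ hΩb w s hw hw1
  have hbdd : ∀ {g : IntegrandDomain Ω d → ℝ}, Continuous g →
      UniformContinuous (g ∘ toIntegrandDomain) ∧ ∃ C, ∀ q : OpenDomain Ω d,
        |(g ∘ toIntegrandDomain) q| ≤ C := by
    intro g hg
    obtain ⟨C, hC⟩ := (isCompact_range hg).isBounded.exists_norm_le
    exact ⟨(CompactSpace.uniformContinuous_of_continuous hg).comp
      isometry_toIntegrandDomain.uniformContinuous, C, fun q => hC _ ⟨_, rfl⟩⟩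
  have haff : ∀ x, ∑ i, w x i * (1 - (s x i : ℝ)) = 1 - variationRatio μ ν x := fun x => by
    simp_rw [mul_sub, mul_one]
    rw [Finset.sum_sub_distrib, hw1, hws]
  have hfst : ∀ (φ : Ω → ℝ), UniformContinuous φ → (∃ C, ∀ x, |φ x| ≤ C) →
      ∀ h : USphere d → ℝ, Continuous h →
      Tendsto (fun k => ∫ x, φ x * (‖u k x‖ * h (unitDir (u k x))) ∂(leb Ω)) atTop
        (𝓝 (∫ x, φ x * h (polarDir μ x) ∂μ.variation)) := by
    rintro φ hφ ⟨C, hC⟩ h hh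
    obtain ⟨hg, C', hC'⟩ := hbdd (g := fun p => (p.2.1 : ℝ) * h p.2.2.1) (by fun_prop)
    set g : OpenDomain Ω d → ℝ := fun p => φ p.1 * (p.2.1 * h p.2.2.1)
    have hgu : UniformContinuous g := uniformContinuous_mul_of_bounded
      (hφ.comp uniformContinuous_fst) hg (C := max C C')
      (fun q => (hC _).trans (le_max_left _ _)) fun q => (hC' q).trans (le_max_right _ _)
    have hgb : ∃ C, ∀ q, |g q| ≤ C := ⟨C * C', fun q => by
      rw [abs_mul]
      exact mul_le_mul (hC _) (hC' q) (abs_nonneg _) ((abs_nonneg _).trans (hC q.1))⟩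
    have := huv g g hgu hgb ⟨fun x ξ ξ' ζ => by simp [g], fun x ξ ζ ζ' => rfl⟩ hgu hgb
      (fun x => by
        simp only [g, polarPoint]
        rw [← hws x, Finset.sum_mul, Finset.mul_sum]
        exact Finset.sum_congr rfl fun i _ => by ring)
    rw [← integral_variationRatio_mul μ ν]
    convert this using 3 with k
    · ext x
      simp only [pairDensity, g]
      linear_combination -φ x * h (unitDir (u k x)) * massRatio_mul (u k x) (v k x)
    · ext x
      simp only [g, polarPoint]
      ring
  have hsnd : ∀ (φ : Ω → ℝ), UniformContinuous φ → (∃ C, ∀ x, |φ x| ≤ C) →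
      ∀ h : USphere d → ℝ, Continuous h →
      Tendsto (fun k => ∫ x, φ x * (‖v k x‖ * h (unitDir (v k x))) ∂(leb Ω)) atTop
        (𝓝 (∫ x, φ x * h (polarDir ν x) ∂ν.variation)) := by
    rintro φ hφ ⟨C, hC⟩ h hh
    obtain ⟨hg, C', hC'⟩ := hbdd (g := fun p => (1 - (p.2.1 : ℝ)) * h p.2.2.2) (by fun_prop)
    obtain ⟨-, C'', hC''⟩ := hbdd (g := fun p => h p.2.2.2) (by fun_prop)
    set g : OpenDomain Ω d → ℝ := fun p => φ p.1 * ((1 - p.2.1) * h p.2.2.2)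
    have hgu : UniformContinuous g := uniformContinuous_mul_of_bounded
      (hφ.comp uniformContinuous_fst) hg (C := max C C')
      (fun q => (hC _).trans (le_max_left _ _)) fun q => (hC' q).trans (le_max_right _ _)
    have hgb : ∃ C, ∀ q, |g q| ≤ C := ⟨C * C', fun q => by
      rw [abs_mul]
      exact mul_le_mul (hC _) (hC' q) (abs_nonneg _) ((abs_nonneg _).trans (hC q.1))⟩
    have := huv g g hgu hgb ⟨fun x ξ ξ' ζ => rfl, fun x ξ ζ ζ' => by simp [g]⟩ hgu hgb
      (fun x => by
        simp only [g, polarPoint]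
        rw [← haff x, Finset.sum_mul, Finset.mul_sum]
        exact Finset.sum_congr rfl fun i _ => by ring)
    have hint : Integrable (fun x => φ x * h (polarDir ν x)) (μ.variation + ν.variation) := by
      refine Integrable.of_bound (hφ.continuous.measurable.mul
        (hh.measurable.comp (measurable_polarDir ν))).aestronglyMeasurable (C * C'')
        (.of_forall fun x => ?_)
      rw [norm_mul]
      exact mul_le_mul (hC x) (hC'' (polarPoint μ ν x)) (norm_nonneg _)
        ((abs_nonneg _).trans (hC x))
    rw [← integral_one_sub_variationRatio_mul μ ν hint]
    convert this using 3 with k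
    · ext x
      simp only [pairDensity, g]
      linear_combination φ x * h (unitDir (v k x)) * massRatio_mul (u k x) (v k x)
    · ext x
      simp only [g, polarPoint]
      ring
  have hunit : ∀ (y : Euc d) (i : Fin d), ‖y‖ * (unitDir y : Euc d) i = y i := fun y i => by
    conv_rhs => rw [← norm_smul_unitDir y]
    rfl
  have hC₀ : ∀ φ : C₀(Ω, ℝ), UniformContinuous φ ∧ ∃ C, ∀ x, |φ x| ≤ C := fun φ =>
    ⟨ZeroAtInftyContinuousMap.uniformContinuous φ, ‖φ‖, fun x => φ.toBCF.norm_coe_le_norm x⟩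
  have hone : UniformContinuous (fun _ : Ω => (1 : ℝ)) ∧ ∃ C, ∀ x : Ω, |(1 : ℝ)| ≤ C :=
    ⟨uniformContinuous_const, 1, by simp⟩
  refine ⟨u, v, ⟨weakStarTendsto_of_coordinates fun φ i => ?_, ?_⟩,
    ⟨weakStarTendsto_of_coordinates fun φ i => ?_, ?_⟩, ?_⟩
  · simpa only [hunit] using hfst φ (hC₀ φ).1 (hC₀ φ).2 (fun ξ => (ξ : Euc d) i) (by fun_prop)
  · have := hfst _ hone.1 hone.2 (fun _ => 1) continuous_const
    simpa [L1.norm_eq_integral_norm, measureReal_def] using this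
  · simpa only [hunit] using hsnd φ (hC₀ φ).1 (hC₀ φ).2 (fun ξ => (ξ : Euc d) i) (by fun_prop)
  · have := hsnd _ hone.1 hone.2 (fun _ => 1) continuous_const
    simpa [L1.norm_eq_integral_norm, measureReal_def] using this
  · obtain ⟨hg, hgb⟩ := hbdd hf
    obtain ⟨hk, hkb⟩ := hbdd (continuous_hullInRatio hf)
    exact huv _ _ hg hgb ⟨fun x ξ ξ' ζ => hf0 _ _ _ _ _, fun x ξ ζ ζ' => hf1 _ _ _ _ _⟩ hk hkb hwf

end Relaxation

theorem theorem4p2 {n d : ℕ} [NeZero n] [NeZero d] (Ω : Set (Euc n)) (hΩ : IsOpen Ω)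
    (hΩb : Bornology.IsBounded Ω) (f : IntegrandDomain Ω d → ℝ) (hf : Continuous f)
    (hfb : ∃ C : ℝ, ∀ p, |f p| ≤ C)
    (hf0 : ∀ x : closure Ω, ∀ ξ ζ ξ' ζ' : USphere d, f (x, 0, ξ, ζ) = f (x, 0, ξ', ζ'))
    (hf1 : ∀ x : closure Ω, ∀ ξ ζ ξ' ζ' : USphere d, f (x, 1, ξ, ζ) = f (x, 1, ξ', ζ'))
    (μ ν : RadonVec Ω d) :
    Integrable (measIntegrand (hullInRatio f) μ ν) (μ.variation + ν.variation) ∧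
      relaxation f μ ν = (measFunctional (hullInRatio f) μ ν : EReal) := by

  have hi := integrable_measIntegrand_hullInRatio (μ := μ) (ν := ν) hΩb hf
  refine ⟨hi, le_antisymm ?_ ?_⟩
  · obtain ⟨u, v, hu, hv, hlim⟩ := exists_recovery_sequence hΩ hΩb hf hf0 hf1 μ ν
    refine sInf_le ⟨u, v, hu, hv, ?_⟩
    exact ((continuous_coe_real_ereal.tendsto _).comp hlim).liminf_eq.symm
  · refine le_sInf ?_
    rintro _ ⟨u, v, hu, hv, rfl⟩
    refine le_of_forall_lt fun c hc => ?_
    obtain ⟨y, hcy, hy⟩ := EReal.lt_iff_exists_real_btwn.1 hc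
    obtain ⟨ℓ, hℓ, hyℓ⟩ := exists_affineMinorant_integral_gt hΩ hΩb hf hf0 hf1 hi
      (EReal.coe_lt_coe_iff.1 hy)
    obtain ⟨C, hC⟩ := hfb
    refine hcy.trans_le (le_liminf_of_le (by isBoundedDefault) ?_)
    filter_upwards [hℓ.eventually_lt hΩ (hf.comp continuous_toIntegrandDomain)
      (fun p => hC _) hu hv hyℓ] with k hk
    rw [lebFunctional_eq]
    exact EReal.coe_le_coe_iff.2 hk.le
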